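/- Let $\mu,g,L>0$. For $a>0$ let $u_a:[0,\infty)\to\mathbb R$ be the solution of $$u''(\bar s)+\frac{u(\bar s)}{\sqrt{\bar s^2+u(\bar s)^2}}=0,\qquad u(0)=0,\quad u'(0)=a .$$ For bounds $a_{\max},\bar L_{\max}\in(0,\infty]$ let $$\mathcal S=\mathcal S_{a_{\max},\bar L_{\max}}=\{(\bar s,u_a(\bar s),u_a'(\bar s)) : 0<a<a_{\max},\ 0<\bar s<\bar L_{\max}\}\subset\mathbb R^3 .$$ A (non-trivial) configuration of the rotating chain of length $L$ and linear density $\mu$ is a pair $(\omega,\rho)$ with $\omega>0$ and $\rho:[0,L]\to\mathbb R$ differentiable, $|\rho'|<1$, $\rho(0)>0$ and $$\frac{d}{ds}\Big(\frac{\mu g s}{\sqrt{1-\rho'^2}}\,\rho'\Big)+\mu\rho\,\omega^2=0\quad\text{on }[0,L].$$ Its attachment radius is $r=\rho(L)$; it is in rotation mode $k$ if $\rho$ has exactly $k$ zeros in $(0,L)$; and it is represented by the point $$\Big(\frac{L\omega^2}{g},\ -\frac{\rho'(L)}{\sqrt{1-\rho'(L)^2}}\cdot\frac{L\omega^2}{g},\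 \frac{\rho(L)\,\omega^2}{g}\Big),$$ which is $(\bar L,u_a(\bar L),u_a'(\bar L))$ with $\bar L=L\omega^2/g$ and $a=\rho(0)\omega^2/g$. For $i\ge 1$, the $i$-th zero-radius locus on $\mathcal S$ is the set of points of $\mathcal S$ that represent configurations with $r=0$ for which $s=L$ is the $i$-th zero of $\rho$ in $(0,L]$. Let $i\ge1$. The Bessel function $J_0$ has an $i$-th positive zero $h_i$. Put $\omega_i=\frac{h_i}{2}\sqrt{g/L}$ and $\bar L_i=L\omega_i^2/g$. Then: (i) If $\bar L_i<\bar L_{\max}$, the $i$-th zero-radius locus is a curve that branches out from the $\bar s$-axis at $(\bar L_i,0,0)$: there is a topological embedding $\gamma:[0,\infty)\to\mathbb R^3$ with $\gamma(0)=(\bar L_i,0,0)$ such that $\gamma((0,\infty))$ is the locus and does not meet the $\bar s$-axis; moreover, for all real $a<a_{\max}$ and $l<\bar L_{\max}$, $\gamma(t)\notin\mathcal S_{a,l}$ for all large $t$. If $a_{\max}=\bar L_{\max}=\infty$, the curve is infinite: $\|\gamma(t)\|\to\infty$ as $t\to\infty$. (ii) The $i$-th zero-radius locus separates, on $\mathcal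 S$, the configurations in rotation mode $i-1$ from those in rotation mode $i$: every connected subset of $\mathcal S$ (in particular every path in $\mathcal S$) that contains a point representing a configuration in mode $i-1$ and a point representing a configuration in mode $i$ meets the $i$-th zero-radius locus. -/

import Mathlib

namespace RotatingChain

open Set

/-- `z` is the `i`-th positive zero of `f` (counted from `i = 1`): `f z = 0`, and `f` has exactly
`i - 1` zeros in the open interval `(0, z)`. -/
def IsNthZero (f : ℝ → ℝ) (i : ℕ) (z : ℝ) : Prop :=
  0 < z ∧ f z = 0 ∧ {x ∈ Ioo 0 z | f x = 0}.encard + 1 = (i : ℕ∞)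

/-- The Bessel function `J₀`, by its power series. -/
noncomputable def besselJ0 (x : ℝ) : ℝ :=
  ∑' k : ℕ, (-1) ^ k / ((k.factorial : ℝ) ^ 2) * (x / 2) ^ (2 * k)

/-- The discrete angular speed `(h / 2) √(g / L)` attached to a zero `h` of `J₀`. -/
noncomputable def discreteSpeed (g L h : ℝ) : ℝ := h / 2 * √(g / L)

/-- The dimensionless length `L ω² / g`. -/
noncomputable def dimlessLength (g L ω : ℝ) : ℝ := L * ω ^ 2 / g

/-- `u` (with derivative `v = u'`) solves the dimensionless shape equation
`u'' + u / √(s² + u²) = 0` on `[0, ∞)` with `u 0 = 0` and `u' 0 = a`. At the singular point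
`s = 0` the second-order equation is replaced by continuity of `u'`. -/
structure IsShot (a : ℝ) (u v : ℝ → ℝ) : Prop where
  u_zero : u 0 = 0
  v_zero : v 0 = a
  deriv_u : ∀ s, 0 ≤ s → HasDerivWithinAt u (v s) (Ici 0) s
  cont_v : ContinuousOn v (Ici 0)
  deriv_v : ∀ s, 0 < s → HasDerivAt v (-(u s / √(s ^ 2 + u s ^ 2))) s

/-- The surface `𝒮`: the union over `0 < a < aMax` of the curves `(s, u_a s, u_a' s)`,
`0 < s < LMax`. The bounds may be finite or infinite. -/
def surface (aMax LMax : EReal) : Set (ℝ × ℝ × ℝ) :=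
  {p | ∃ (a s : ℝ) (u v : ℝ → ℝ), 0 < a ∧ (a : EReal) < aMax ∧ 0 < s ∧ (s : EReal) < LMax ∧
    IsShot a u v ∧ p = (s, u s, v s)}

/-- The slope `ρ'` of a shape function on `[0, L]` (one-sided at the two ends). -/
noncomputable def slope (L : ℝ) (ρ : ℝ → ℝ) (s : ℝ) : ℝ := derivWithin ρ (Icc 0 L) s

/-- `(ω, ρ)` is a non-trivial configuration of the chain of length `L` and linear density `μ`:
`(μ g s ρ' / √(1 - ρ'²))' + μ ρ ω² = 0` on `[0, L]`, with `ω > 0` and `ρ 0 > 0`; here `s = 0` is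
the free end and `s = L` the attached end. The attachment radius is `ρ L`. -/
structure IsConfiguration (μ g L ω : ℝ) (ρ : ℝ → ℝ) : Prop where
  speed_pos : 0 < ω
  free_end_pos : 0 < ρ 0
  differentiable : DifferentiableOn ℝ ρ (Icc 0 L)
  slope_lt : ∀ s ∈ Icc 0 L, |slope L ρ s| < 1
  equation : ∀ s ∈ Icc 0 L,
    HasDerivWithinAt (fun t => μ * g * t / √(1 - slope L ρ t ^ 2) * slope L ρ t)
      (-(μ * ρ s * ω ^ 2)) (Icc 0 L) s

/-- The point of `ℝ³` that represents a configuration, `(L̄, u L̄, u' L̄)` with `L̄ = L ω² / g`.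
In the variable `U = ρ' / √(1 - ρ'²) · s ω² / g` one has `U' = -ρ ω² / g`, so `U' 0 < 0`; as `U` and
`-U` describe the same configuration, the representative `u = -U`, with `u' 0 > 0`, is taken. -/
noncomputable def endpoint (g L ω : ℝ) (ρ : ℝ → ℝ) : ℝ × ℝ × ℝ :=
  (dimlessLength g L ω,
    -(slope L ρ L / √(1 - slope L ρ L ^ 2) * (L * ω ^ 2 / g)),
    ρ L * ω ^ 2 / g)

/-- The `i`-th zero-radius locus on the surface: the points representing configurations with
attachment radius `ρ L = 0` for which the attached end is the `i`-th zero of the shape function. -/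
def zeroRadiusLocus (μ g L : ℝ) (aMax LMax : EReal) (i : ℕ) : Set (ℝ × ℝ × ℝ) :=
  {p ∈ surface aMax LMax | ∃ (ω : ℝ) (ρ : ℝ → ℝ), IsConfiguration μ g L ω ρ ∧
    endpoint g L ω ρ = p ∧ IsNthZero ρ i L}

/-- The points of the surface representing configurations in rotation mode `i`: the shape function
has exactly `i` zeros strictly between the two ends of the chain. -/
def rotationMode (μ g L : ℝ) (aMax LMax : EReal) (i : ℕ) : Set (ℝ × ℝ × ℝ) :=
  {p ∈ surface aMax LMax | ∃ (ω : ℝ) (ρ : ℝ → ℝ), IsConfiguration μ g L ω ρ ∧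
    endpoint g L ω ρ = p ∧ {s ∈ Ioo 0 L | ρ s = 0}.encard = (i : ℕ∞)}

end RotatingChain

/-!
In terms of the normalised radius `y = u_a' / a` the shape equation reads
`y' s = -pull a (s⁻¹ ∫₀ˢ y)`, `y 0 = 1`. This Volterra equation makes sense down to `a = 0`, where
its solution is `J₀ (2 √s)`, and its solution depends continuously on `a`. The angle of the vector
`(y, ∫ y)` is strictly increasing and unbounded in `s`, so `y` has infinitely many zeros
`τ₀ a < τ₁ a < ⋯`, continuous in `a`. Sturm comparison of the solution with its derivative in `a`
shows that each `τₙ` is strictly increasing on `[0, ∞)`.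

A configuration is a rescaled piece of a shot, so the `(n + 1)`-st zero-radius locus consists of the
points with `s = τₙ a`: a curve that starts at `(τₙ 0, 0, 0)`, where `2 √(τₙ 0)` is the
`(n + 1)`-st zero of `J₀`. The initial slope `a` is a continuous function on the surface, and modes
`n` and `n + 1` lie on different sides of `s = τₙ a`.
-/

namespace RotatingChain

open Set Filter Topology
open scoped NNReal

section Mean

variable {E : Type*} [NormedAddCommGroup E] [NormedSpace ℝ E]

/-- The mean value of `y` over the segment from `0` to `t`, written as an integral over `[0, 1]` so
that its value at `t = 0` is `y 0`. -/
noncomputable def mean (y : ℝ → E) (t : ℝ) : E := ∫ θ in (0 : ℝ)..1, y (θ * t)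

@[fun_prop]
theorem continuous_mean {X : Type*} [TopologicalSpace X] {y : X → ℝ → E}
    (hy : Continuous fun p : X × ℝ => y p.1 p.2) {t : X → ℝ} (ht : Continuous t) :
    Continuous fun x => mean (y x) (t x) :=
  intervalIntegral.continuous_parametric_intervalIntegral_of_continuous'
    (f := fun x θ => y x (θ * t x))
    (hy.comp (f := fun q : X × ℝ => (q.1, q.2 * t q.1)) (by fun_prop)) 0 1

theorem smul_mean (y : ℝ → E) (t : ℝ) : t • mean y t = ∫ x in (0 : ℝ)..t, y x := by
  rw [mean, intervalIntegral.smul_integral_comp_mul_right, zero_mul, one_mul]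

theorem mean_congr {y₁ y₂ : ℝ → E} {t : ℝ} (ht : 0 ≤ t) (h : EqOn y₁ y₂ (Icc 0 t)) :
    mean y₁ t = mean y₂ t := by
  refine intervalIntegral.integral_congr fun θ hθ => ?_
  rw [uIcc_of_le zero_le_one] at hθ
  exact h ⟨mul_nonneg hθ.1 ht, mul_le_of_le_one_left ht hθ.2⟩

theorem mean_sub {y₁ y₂ : ℝ → E} (h₁ : Continuous y₁) (h₂ : Continuous y₂) (t : ℝ) :
    mean (fun x => y₁ x - y₂ x) t = mean y₁ t - mean y₂ t := by
  apply intervalIntegral.integral_sub <;> apply Continuous.intervalIntegrable <;> fun_prop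

theorem mean_const_mul (c : ℝ) (y : ℝ → ℝ) (t : ℝ) :
    mean (fun x => c * y x) t = c * mean y t :=
  intervalIntegral.integral_const_mul c _

theorem norm_mean_le {y : ℝ → E} {t C : ℝ} (ht : 0 ≤ t) (h : ∀ x ∈ Icc 0 t, ‖y x‖ ≤ C) :
    ‖mean y t‖ ≤ C := by
  have hC : ∀ θ ∈ uIoc (0 : ℝ) 1, ‖y (θ * t)‖ ≤ C := fun θ hθ => by
    rw [uIoc_of_le zero_le_one] at hθ
    exact h _ ⟨mul_nonneg hθ.1.le ht, mul_le_of_le_one_left ht hθ.2⟩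
  simpa [mean] using intervalIntegral.norm_integral_le_of_norm_le_const hC

theorem hasDerivAt_smul_mean [CompleteSpace E] {y : ℝ → E} (hy : Continuous y) (s : ℝ) :
    HasDerivAt (fun t => t • mean y t) (y s) s := by
  simpa only [smul_mean] using (hy.integral_hasStrictDerivAt 0 s).hasDerivAt

end Mean

section Volterra

theorem eventually_forall_norm_sub_le_of_isCompact {X T E : Type*} [TopologicalSpace X]
    [TopologicalSpace T] [SeminormedAddCommGroup E] {s : Set T} (hs : IsCompact s) {F : X → T → E}
    (hF : Continuous fun p : X × T => F p.1 p.2) (a : X) {δ : ℝ} (hδ : 0 < δ) :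
    ∀ᶠ b in 𝓝 a, ∀ t ∈ s, ‖F a t - F b t‖ ≤ δ := by
  refine hs.eventually_forall_of_forall_eventually fun t _ => ?_
  have hcont : Continuous fun p : X × T => ‖F a p.2 - F p.1 p.2‖ :=
    ((hF.comp (by fun_prop : Continuous fun p : X × T => (a, p.2))).sub hF).norm
  exact (hcont.tendsto' (a, t) 0 (by simp)).eventually_le_const hδ

variable {E : Type*} [NormedAddCommGroup E] [NormedSpace ℝ E]

/-- `y` is the continuous solution of the singular initial value problem
`y' s = -G s (s⁻¹ ∫₀ˢ y)` for `s ≥ 0`, `y 0 = c`, in integrated form. It is extended by the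
constant `c` to negative `s`, so that it is determined on the whole line. -/
structure IsVolterra (c : E) (G : ℝ → E → E) (y : ℝ → E) : Prop where
  cont : Continuous y
  eq_sub_integral : ∀ s, y s = c - ∫ t in (0 : ℝ)..max s 0, G t (mean y t)

variable {c c₁ c₂ : E} {G G₁ G₂ : ℝ → E → E} {y y₁ y₂ : ℝ → E} {K : ℝ≥0}

theorem continuous_comp_mean (hG : Continuous fun p : ℝ × E => G p.1 p.2) (hy : Continuous y) :
    Continuous fun t => G t (mean y t) :=
  hG.comp (by fun_prop : Continuous fun t => (t, mean y t))

theorem IsVolterra.eq_of_nonneg (h : IsVolterra c G y) {s : ℝ} (hs : 0 ≤ s) :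
    y s = c - ∫ t in (0 : ℝ)..s, G t (mean y t) := by
  simpa only [max_eq_left hs] using h.eq_sub_integral s

theorem IsVolterra.eq_of_nonpos (h : IsVolterra c G y) {s : ℝ} (hs : s ≤ 0) : y s = c := by
  simpa only [max_eq_right hs, intervalIntegral.integral_same, sub_zero] using h.eq_sub_integral s

theorem IsVolterra.hasDerivWithinAt [CompleteSpace E] (h : IsVolterra c G y)
    (hG : Continuous fun p : ℝ × E => G p.1 p.2) {s : ℝ} (hs : 0 ≤ s) :
    HasDerivWithinAt y (-G s (mean y s)) (Ici 0) s :=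
  (((continuous_comp_mean hG h.cont).integral_hasStrictDerivAt 0 s).hasDerivAt.const_sub
    c).hasDerivWithinAt.congr (fun _ ht => h.eq_of_nonneg ht) (h.eq_of_nonneg hs)

theorem integral_mul_exp_two_mul (K s : ℝ) :
    ∫ t in (0 : ℝ)..s, K * Real.exp (2 * K * t) = (Real.exp (2 * K * s) - 1) / 2 := by
  have hderiv : ∀ t ∈ uIcc 0 s,
      HasDerivAt (fun t => Real.exp (2 * K * t) / 2) (K * Real.exp (2 * K * t)) t := fun t _ =>
    (((hasDerivAt_id' t).const_mul (2 * K)).exp.div_const 2).congr_deriv (by ring)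
  rw [intervalIntegral.integral_eq_sub_of_hasDerivAt hderiv
    (Continuous.intervalIntegrable (by fun_prop) _ _)]
  simp only [mul_zero, Real.exp_zero]
  ring

theorem norm_integral_sub_integral_le (hG₁ : Continuous fun p : ℝ × E => G₁ p.1 p.2)
    (hG₂ : Continuous fun p : ℝ × E => G₂ p.1 p.2) (hK : ∀ t, LipschitzWith K (G₂ t))
    (hy₁ : Continuous y₁) (hy₂ : Continuous y₂) {δ M s : ℝ} (hs : 0 ≤ s)
    (hδ : ∀ t ∈ Icc 0 s, ‖G₁ t (mean y₁ t) - G₂ t (mean y₁ t)‖ ≤ δ)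
    (hM : ∀ t ∈ Icc 0 s, ‖y₁ t - y₂ t‖ ≤ M * Real.exp (2 * K * t)) :
    ‖(∫ t in (0 : ℝ)..s, G₁ t (mean y₁ t)) - ∫ t in (0 : ℝ)..s, G₂ t (mean y₂ t)‖ ≤
      s * δ + M * (Real.exp (2 * K * s) - 1) / 2 := by
  have hM0 : 0 ≤ M := by
    simpa using (norm_nonneg _).trans (hM 0 ⟨le_rfl, hs⟩)
  have hmean : ∀ t ∈ Icc 0 s, ‖mean y₁ t - mean y₂ t‖ ≤ M * Real.exp (2 * K * t) := by
    intro t ht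
    rw [← mean_sub hy₁ hy₂]
    refine norm_mean_le ht.1 fun x hx => (hM x ⟨hx.1, hx.2.trans ht.2⟩).trans ?_
    gcongr
    exact hx.2
  have hintegrand : ∀ t ∈ Icc 0 s,
      ‖G₁ t (mean y₁ t) - G₂ t (mean y₂ t)‖ ≤ δ + M * (K * Real.exp (2 * K * t)) := fun t ht =>
    calc ‖G₁ t (mean y₁ t) - G₂ t (mean y₂ t)‖
        ≤ ‖G₁ t (mean y₁ t) - G₂ t (mean y₁ t)‖ + ‖G₂ t (mean y₁ t) - G₂ t (mean y₂ t)‖ :=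
          norm_sub_le_norm_sub_add_norm_sub _ _ _
      _ ≤ δ + K * (M * Real.exp (2 * K * t)) :=
          add_le_add (hδ t ht) ((hK t).norm_sub_le_of_le (hmean t ht))
      _ = δ + M * (K * Real.exp (2 * K * t)) := by ring
  rw [← intervalIntegral.integral_sub ((continuous_comp_mean hG₁ hy₁).intervalIntegrable _ _)
    ((continuous_comp_mean hG₂ hy₂).intervalIntegrable _ _)]
  calc _ ≤ ∫ t in (0 : ℝ)..s, (δ + M * (K * Real.exp (2 * K * t))) :=
        intervalIntegral.norm_integral_le_of_norm_le hs
          (.of_forall fun t ht => hintegrand t (Ioc_subset_Icc_self ht))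
          (Continuous.intervalIntegrable (by fun_prop) _ _)
    _ = s * δ + M * (Real.exp (2 * K * s) - 1) / 2 := by
        rw [intervalIntegral.integral_add (by simp)
          (Continuous.intervalIntegrable (by fun_prop) _ _), intervalIntegral.integral_const_mul,
          integral_mul_exp_two_mul, intervalIntegral.integral_const, smul_eq_mul, sub_zero,
          mul_div_assoc]

theorem le_mul_exp_of_forall_le_mul_exp {φ : ℝ → ℝ} {K S ε : ℝ} (hK : 0 ≤ K)
    (hφ : ContinuousOn φ (Icc 0 S)) (hφ0 : ∀ t ∈ Icc 0 S, 0 ≤ φ t)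
    (h : ∀ M, (∀ t ∈ Icc 0 S, φ t ≤ M * Real.exp (2 * K * t)) →
      ∀ s ∈ Icc 0 S, φ s ≤ ε + M * (Real.exp (2 * K * s) - 1) / 2) {s : ℝ} (hs : s ∈ Icc 0 S) :
    φ s ≤ ε * Real.exp (2 * K * s) := by
  have hcont : ContinuousOn (fun t => φ t / Real.exp (2 * K * t)) (Icc 0 S) :=
    hφ.div (by fun_prop) fun t _ => (Real.exp_pos _).ne'
  obtain ⟨m, hm, hmax⟩ := isCompact_Icc.exists_isMaxOn ⟨s, hs⟩ hcont
  set M := φ m / Real.exp (2 * K * m) with hM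
  have hM0 : 0 ≤ M := div_nonneg (hφ0 m hm) (Real.exp_pos _).le
  have hle : ∀ t ∈ Icc 0 S, φ t ≤ M * Real.exp (2 * K * t) := fun t ht =>
    (div_le_iff₀ (Real.exp_pos _)).1 (hmax ht)
  have hMm : M * Real.exp (2 * K * m) ≤ ε + M * (Real.exp (2 * K * m) - 1) / 2 := by
    rw [hM, div_mul_cancel₀ _ (Real.exp_pos _).ne', ← hM]
    exact h M hle m hm
  have hexp : 1 ≤ Real.exp (2 * K * m) :=
    Real.one_le_exp (mul_nonneg (by positivity) hm.1)
  have hMε : M ≤ ε := by nlinarith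
  exact (hle s hs).trans (by gcongr)

theorem IsVolterra.norm_sub_le (h₁ : IsVolterra c₁ G₁ y₁) (h₂ : IsVolterra c₂ G₂ y₂)
    (hG₁ : Continuous fun p : ℝ × E => G₁ p.1 p.2) (hG₂ : Continuous fun p : ℝ × E => G₂ p.1 p.2)
    (hK : ∀ t, LipschitzWith K (G₂ t)) {S δ : ℝ} (hδ0 : 0 ≤ δ)
    (hδ : ∀ t ∈ Icc 0 S, ‖G₁ t (mean y₁ t) - G₂ t (mean y₁ t)‖ ≤ δ) {s : ℝ} (hs : s ∈ Icc 0 S) :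
    ‖y₁ s - y₂ s‖ ≤ (‖c₁ - c₂‖ + S * δ) * Real.exp (2 * K * s) := by
  refine le_mul_exp_of_forall_le_mul_exp (φ := fun s => ‖y₁ s - y₂ s‖) K.2
    (h₁.cont.sub h₂.cont).norm.continuousOn (fun t _ => norm_nonneg _) (fun M hM s hs => ?_) hs
  have hint := norm_integral_sub_integral_le hG₁ hG₂ hK h₁.cont h₂.cont hs.1
    (fun t ht => hδ t ⟨ht.1, ht.2.trans hs.2⟩) (fun t ht => hM t ⟨ht.1, ht.2.trans hs.2⟩)
  rw [h₁.eq_of_nonneg hs.1, h₂.eq_of_nonneg hs.1, sub_sub_sub_comm]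
  calc _ ≤ ‖c₁ - c₂‖ + (s * δ + M * (Real.exp (2 * K * s) - 1) / 2) :=
        norm_sub_le_of_le le_rfl hint
    _ ≤ ‖c₁ - c₂‖ + (S * δ + M * (Real.exp (2 * K * s) - 1) / 2) := by
        gcongr
        exact hs.2
    _ = _ := (add_assoc _ _ _).symm

theorem IsVolterra.unique (h₁ : IsVolterra c G y₁) (h₂ : IsVolterra c G y₂)
    (hG : Continuous fun p : ℝ × E => G p.1 p.2) (hK : ∀ t, LipschitzWith K (G t)) :
    y₁ = y₂ := by
  ext s
  rcases le_total s 0 with hs | hs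
  · rw [h₁.eq_of_nonpos hs, h₂.eq_of_nonpos hs]
  · have := h₁.norm_sub_le h₂ hG hG hK (S := s) le_rfl (by simp) ⟨hs, le_rfl⟩
    rw [← sub_eq_zero, ← norm_le_zero_iff]
    simpa using this

theorem continuous_uncurry_of_isVolterra {X : Type*} [TopologicalSpace X] {c : X → E}
    {G : X → ℝ → E → E} {y : X → ℝ → E} (hc : Continuous c)
    (hG : Continuous fun p : X × ℝ × E => G p.1 p.2.1 p.2.2) (hK : ∀ a t, LipschitzWith K (G a t))
    (hy : ∀ a, IsVolterra (c a) (G a) (y a)) : Continuous fun p : X × ℝ => y p.1 p.2 := by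
  have hGa : ∀ a, Continuous fun p : ℝ × E => G a p.1 p.2 := fun a =>
    hG.comp (by fun_prop : Continuous fun p : ℝ × E => (a, p))
  rw [continuous_iff_continuousAt]
  rintro ⟨a, s⟩
  have hdist : Tendsto (fun p : X × ℝ => y a p.2 - y p.1 p.2) (𝓝 (a, s)) (𝓝 0) := by
    rw [Metric.tendsto_nhds]
    intro ε hε
    set S := |s| + 1
    have hS : 0 < 1 + S := by positivity
    set δ := ε / (2 * (1 + S) * Real.exp (2 * K * S)) with hδ
    have hδ0 : 0 < δ := by positivity
    have hbound : (δ + S * δ) * Real.exp (2 * K * S) < ε := by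
      have : (δ + S * δ) * Real.exp (2 * K * S) = ε / 2 := by rw [hδ]; field_simp
      linarith
    have hya := (hy a).cont
    have hclose := eventually_forall_norm_sub_le_of_isCompact (isCompact_Icc (a := 0) (b := S))
      (F := fun b t => G b t (mean (y a) t)) (hG.comp (by fun_prop :
        Continuous fun p : X × ℝ => (p.1, p.2, mean (y a) p.2))) a hδ0
    have hcδ : ∀ᶠ b in 𝓝 a, ‖c a - c b‖ ≤ δ :=
      ((continuous_const.sub hc).norm.tendsto' a 0 (by simp)).eventually_le_const hδ0
    have hsS : ∀ᶠ t in 𝓝 s, t < S := eventually_lt_nhds (by linarith [le_abs_self s])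
    filter_upwards [(hclose.and hcδ).prod_nhds hsS] with p ⟨⟨hpG, hpc⟩, hpS⟩
    rw [dist_zero_right]
    refine lt_of_le_of_lt ?_ hbound
    rcases le_total p.2 0 with hp | hp
    · rw [(hy _).eq_of_nonpos hp, (hy _).eq_of_nonpos hp]
      calc ‖c a - c p.1‖ ≤ δ + S * δ := hpc.trans (le_add_of_nonneg_right (by positivity))
        _ ≤ _ := le_mul_of_one_le_right (by positivity) (Real.one_le_exp (by positivity))
    · refine ((hy a).norm_sub_le (hy p.1) (hGa _) (hGa _) (hK _) hδ0.le hpG ⟨hp, hpS.le⟩).trans ?_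
      gcongr
  simpa [ContinuousAt] using (((hy a).cont.comp continuous_snd).tendsto (a, s)).sub hdist

section Existence

open BoundedContinuousFunction

/-- The function `s ↦ e^{2Ks} z s` (with the weight frozen for `s ≤ 0`): in the norm of `z`, the
Volterra operator of a `K`-Lipschitz force is a contraction. -/
noncomputable def expWeighted (K : ℝ≥0) (z : ℝ →ᵇ E) (s : ℝ) : E :=
  Real.exp (2 * K * max s 0) • z s

theorem continuous_expWeighted (K : ℝ≥0) (z : ℝ →ᵇ E) : Continuous (expWeighted K z) := by
  unfold expWeighted
  fun_prop

theorem norm_expWeighted_sub_le (K : ℝ≥0) (z₁ z₂ : ℝ →ᵇ E) {s : ℝ} (hs : 0 ≤ s) :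
    ‖expWeighted K z₁ s - expWeighted K z₂ s‖ ≤ dist z₁ z₂ * Real.exp (2 * K * s) := by
  rw [expWeighted, expWeighted, ← smul_sub, norm_smul, Real.norm_of_nonneg (Real.exp_pos _).le,
    max_eq_left hs, mul_comm, ← dist_eq_norm]
  gcongr
  exact dist_coe_le_dist s

theorem norm_integral_expWeighted_sub_le (hG : Continuous fun p : ℝ × E => G p.1 p.2)
    (hK : ∀ t, LipschitzWith K (G t)) (z₁ z₂ : ℝ →ᵇ E) {s : ℝ} (hs : 0 ≤ s) :
    ‖(∫ t in (0 : ℝ)..s, G t (mean (expWeighted K z₁) t)) -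
        ∫ t in (0 : ℝ)..s, G t (mean (expWeighted K z₂) t)‖ ≤
      dist z₁ z₂ / 2 * Real.exp (2 * K * s) := by
  have h := norm_integral_sub_integral_le hG hG hK (continuous_expWeighted K z₁)
    (continuous_expWeighted K z₂) (δ := 0) hs (by simp)
    (fun t ht => norm_expWeighted_sub_le K z₁ z₂ ht.1)
  linarith [dist_nonneg (x := z₁) (y := z₂)]

/-- The Volterra operator `y ↦ c - ∫ G t (mean y t)` in the exponentially weighted variable. -/
noncomputable def volterraMap (c : E) (hG : Continuous fun p : ℝ × E => G p.1 p.2)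
    (hK : ∀ t, LipschitzWith K (G t)) (hG0 : ∀ t, G t 0 = 0) (z : ℝ →ᵇ E) : ℝ →ᵇ E :=
  ofNormedAddCommGroup
    (fun s => Real.exp (-(2 * K * max s 0)) •
      (c - ∫ t in (0 : ℝ)..max s 0, G t (mean (expWeighted K z) t)))
    (by
      have hI := intervalIntegral.continuous_primitive (μ := MeasureTheory.volume)
        (fun a b => (continuous_comp_mean hG
          (continuous_expWeighted K z)).intervalIntegrable a b) (0 : ℝ)
      fun_prop)
    (‖c‖ + dist z 0 / 2) (fun s => by
      have hs : 0 ≤ max s 0 := le_max_right _ _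
      have hzero : ∀ t, mean (expWeighted K (0 : ℝ →ᵇ E)) t = 0 := fun t => by
        simp [mean, expWeighted]
      have hint := norm_integral_expWeighted_sub_le hG hK z 0 hs
      simp only [hzero, hG0, intervalIntegral.integral_zero, sub_zero] at hint
      have hexp : Real.exp (-(2 * K * max s 0)) ≤ 1 :=
        Real.exp_le_one_iff.2 (neg_nonpos.2 (by positivity))
      rw [norm_smul, Real.norm_of_nonneg (Real.exp_pos _).le]
      calc _ ≤ Real.exp (-(2 * K * max s 0)) *
            (‖c‖ + dist z 0 / 2 * Real.exp (2 * K * max s 0)) := by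
            gcongr
            exact norm_sub_le_of_le le_rfl hint
        _ = Real.exp (-(2 * K * max s 0)) * ‖c‖ + dist z 0 / 2 := by
            rw [mul_add, mul_left_comm, ← Real.exp_add, neg_add_cancel, Real.exp_zero, mul_one]
        _ ≤ ‖c‖ + dist z 0 / 2 := by
            gcongr
            exact mul_le_of_le_one_left (norm_nonneg _) hexp)

theorem contractingWith_volterraMap (c : E) (hG : Continuous fun p : ℝ × E => G p.1 p.2)
    (hK : ∀ t, LipschitzWith K (G t)) (hG0 : ∀ t, G t 0 = 0) :
    ContractingWith (1 / 2) (volterraMap c hG hK hG0) := by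
  refine ⟨by norm_num, LipschitzWith.of_dist_le_mul fun z₁ z₂ => (dist_le (by positivity)).2 ?_⟩
  intro s
  simp only [volterraMap, coe_ofNormedAddCommGroup]
  rw [dist_eq_norm, ← smul_sub, sub_sub_sub_cancel_left, norm_smul, norm_sub_rev,
    Real.norm_of_nonneg (Real.exp_pos _).le]
  calc _ ≤ Real.exp (-(2 * K * max s 0)) * (dist z₁ z₂ / 2 * Real.exp (2 * K * max s 0)) := by
        gcongr
        exact norm_integral_expWeighted_sub_le hG hK z₁ z₂ (le_max_right _ _)
    _ = dist z₁ z₂ / 2 := by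
        rw [mul_left_comm, ← Real.exp_add, neg_add_cancel, Real.exp_zero, mul_one]
    _ = _ := by push_cast; ring

theorem exists_isVolterra [CompleteSpace E] (c : E) (hG : Continuous fun p : ℝ × E => G p.1 p.2)
    (hK : ∀ t, LipschitzWith K (G t)) (hG0 : ∀ t, G t 0 = 0) : ∃ y, IsVolterra c G y := by
  obtain ⟨z, hz⟩ : ∃ z, volterraMap c hG hK hG0 z = z :=
    ⟨_, (contractingWith_volterraMap c hG hK hG0).fixedPoint_isFixedPt⟩
  refine ⟨expWeighted K z, continuous_expWeighted K z, fun s => ?_⟩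
  conv_lhs => rw [expWeighted, ← hz]
  simp only [volterraMap, coe_ofNormedAddCommGroup]
  rw [smul_smul, ← Real.exp_add, add_neg_cancel, Real.exp_zero, one_smul]

end Existence

end Volterra

section Pull

/-- The restoring force `ρ / √(1 + κ² ρ²)`, a `1`-Lipschitz function of `ρ`; here `cos ∘ arctan` is
the function `x ↦ (1 + x²) ^ (-1/2)`. -/
noncomputable def pull (κ ρ : ℝ) : ℝ := ρ * Real.cos (Real.arctan (κ * ρ))

@[fun_prop]
theorem continuous_pull {X : Type*} [TopologicalSpace X] {κ ρ : X → ℝ} (hκ : Continuous κ)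
    (hρ : Continuous ρ) : Continuous fun x => pull (κ x) (ρ x) := by
  unfold pull
  fun_prop

theorem pull_zero (κ : ℝ) : pull κ 0 = 0 := zero_mul _

theorem pull_neg (κ ρ : ℝ) : pull κ (-ρ) = -pull κ ρ := by
  simp only [pull, mul_neg, Real.arctan_neg, Real.cos_neg, neg_mul]

theorem pull_pos {κ ρ : ℝ} (h : 0 < ρ) : 0 < pull κ ρ := mul_pos h (Real.cos_arctan_pos _)

theorem pull_one_mul (κ ρ : ℝ) : pull 1 (κ * ρ) = κ * pull κ ρ := by
  rw [pull, pull, one_mul, mul_assoc]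

theorem pull_one (ρ : ℝ) : pull 1 ρ = Real.sin (Real.arctan ρ) := by
  rw [pull, one_mul, Real.cos_arctan, Real.sin_arctan, mul_one_div]

theorem abs_pull_one_lt (ρ : ℝ) : |pull 1 ρ| < 1 := by
  rw [pull_one, ← sq_lt_one_iff_abs_lt_one, Real.sin_sq]
  linarith [pow_pos (Real.cos_arctan_pos ρ) 2]

theorem pull_div {κ s : ℝ} (hs : 0 < s) (u : ℝ) :
    pull κ (u / s) = u / √(s ^ 2 + κ ^ 2 * u ^ 2) := by
  have h : s ^ 2 + κ ^ 2 * u ^ 2 = s ^ 2 * (1 + (κ * (u / s)) ^ 2) := by field_simp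
  rw [h, Real.sqrt_mul (sq_nonneg s), Real.sqrt_sq hs.le, pull, Real.cos_arctan, div_mul_div_comm,
    mul_one]

theorem hasDerivAt_pull (κ ρ : ℝ) :
    HasDerivAt (pull κ) (Real.cos (Real.arctan (κ * ρ)) ^ 3) ρ := by
  have hκρ : HasDerivAt (fun x => κ * x) κ ρ := by simpa using (hasDerivAt_id' ρ).const_mul κ
  refine ((hasDerivAt_id' ρ).mul hκρ.arctan.cos).congr_deriv ?_
  have hsin : Real.sin (Real.arctan (κ * ρ)) = κ * ρ * Real.cos (Real.arctan (κ * ρ)) := by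
    rw [← pull_one, pull, one_mul]
  have hcos := Real.cos_sq_arctan (κ * ρ)
  have hsq := Real.sin_sq_add_cos_sq (Real.arctan (κ * ρ))
  rw [hsin] at hsq
  rw [hsin, ← hcos]
  linear_combination (-Real.cos (Real.arctan (κ * ρ))) * hsq

theorem cos_arctan_pow_three_le_one (x : ℝ) : Real.cos (Real.arctan x) ^ 3 ≤ 1 :=
  pow_le_one₀ (Real.cos_arctan_pos x).le (Real.cos_le_one _)

theorem lipschitzWith_pull (κ : ℝ) : LipschitzWith 1 (pull κ) := by
  refine lipschitzWith_of_nnnorm_deriv_le (fun ρ => (hasDerivAt_pull κ ρ).differentiableAt)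
    fun ρ => ?_
  rw [(hasDerivAt_pull κ ρ).deriv, ← NNReal.coe_le_coe, coe_nnnorm,
    Real.norm_of_nonneg (pow_nonneg (Real.cos_arctan_pos _).le 3)]
  exact cos_arctan_pow_three_le_one _

theorem monotone_pull (κ : ℝ) : Monotone (pull κ) :=
  monotone_of_deriv_nonneg (fun ρ => (hasDerivAt_pull κ ρ).differentiableAt) fun ρ => by
    rw [(hasDerivAt_pull κ ρ).deriv]
    exact pow_nonneg (Real.cos_arctan_pos _).le 3

theorem mul_pull_le_pull_mul {κ θ ρ : ℝ} (hθ : θ ∈ Icc 0 1) (hρ : 0 ≤ ρ) :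
    θ * pull κ ρ ≤ pull κ (θ * ρ) := by
  have hsq : (κ * (θ * ρ)) ^ 2 ≤ (κ * ρ) ^ 2 := by
    rw [mul_left_comm, mul_pow θ]
    exact mul_le_of_le_one_left (sq_nonneg _) (pow_le_one₀ hθ.1 hθ.2)
  rw [pull, pull, ← mul_assoc, Real.cos_arctan, Real.cos_arctan]
  have := mul_nonneg hθ.1 hρ
  gcongr

end Pull

section Profile

theorem exists_isVolterra_pull (a : ℝ) : ∃ y, IsVolterra 1 (fun _ ρ => pull a ρ) y :=
  exists_isVolterra 1 (by fun_prop) (fun _ => lipschitzWith_pull a) fun _ => pull_zero a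

/-- The normalised radius `u_a' / a` of the shot with initial slope `a`. The normalisation extends
it to `a = 0`, where the equation becomes Bessel's. -/
noncomputable def profile (a : ℝ) : ℝ → ℝ := (exists_isVolterra_pull a).choose

/-- The normalised shot `u_a / a`. -/
noncomputable def primitive (a s : ℝ) : ℝ := s * mean (profile a) s

theorem isVolterra_profile (a : ℝ) : IsVolterra 1 (fun _ ρ => pull a ρ) (profile a) :=
  (exists_isVolterra_pull a).choose_spec

@[fun_prop]
theorem continuous_profile {X : Type*} [TopologicalSpace X] {a s : X → ℝ} (ha : Continuous a)
    (hs : Continuous s) : Continuous fun x => profile (a x) (s x) := by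
  have huncurry : Continuous fun p : ℝ × ℝ => profile p.1 p.2 :=
    continuous_uncurry_of_isVolterra (c := fun _ => (1 : ℝ)) (G := fun a _ ρ => pull a ρ)
      continuous_const (by fun_prop) (fun a _ => lipschitzWith_pull a) isVolterra_profile
  exact huncurry.comp₂ ha hs

@[fun_prop]
theorem continuous_primitive {X : Type*} [TopologicalSpace X] [FirstCountableTopology X]
    {a s : X → ℝ} (ha : Continuous a) (hs : Continuous s) :
    Continuous fun x => primitive (a x) (s x) := by
  unfold primitive
  fun_prop

theorem profile_of_nonpos (a : ℝ) {s : ℝ} (hs : s ≤ 0) : profile a s = 1 :=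
  (isVolterra_profile a).eq_of_nonpos hs

theorem profile_zero (a : ℝ) : profile a 0 = 1 := profile_of_nonpos a le_rfl

theorem primitive_zero (a : ℝ) : primitive a 0 = 0 := zero_mul _

theorem primitive_div (a : ℝ) {s : ℝ} (hs : s ≠ 0) : primitive a s / s = mean (profile a) s :=
  mul_div_cancel_left₀ _ hs

theorem hasDerivAt_primitive (a s : ℝ) : HasDerivAt (primitive a) (profile a s) s :=
  hasDerivAt_smul_mean (isVolterra_profile a).cont s

theorem hasDerivWithinAt_profile (a : ℝ) {s : ℝ} (hs : 0 ≤ s) :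
    HasDerivWithinAt (profile a) (-pull a (mean (profile a) s)) (Ici 0) s :=
  (isVolterra_profile a).hasDerivWithinAt (by fun_prop) hs

theorem hasDerivAt_profile (a : ℝ) {s : ℝ} (hs : 0 < s) :
    HasDerivAt (profile a) (-pull a (primitive a s / s)) s := by
  rw [primitive_div a hs.ne']
  exact (hasDerivWithinAt_profile a hs.le).hasDerivAt (Ici_mem_nhds hs)

end Profile

section Branch

/-- `(u, v)` solves `u' = v`, `v' = -u / √(s² + κ² u²)` on `(0, T]`, with one-sided derivatives at
`T`. Nothing is required at the singular point `0`. -/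
structure IsBranch (κ T : ℝ) (u v : ℝ → ℝ) : Prop where
  deriv_u : ∀ s ∈ Ioc 0 T, HasDerivWithinAt u (v s) (Ioc 0 T) s
  deriv_v : ∀ s ∈ Ioc 0 T, HasDerivWithinAt v (-pull κ (u s / s)) (Ioc 0 T) s

theorem lipschitzWith_branchField (κ : ℝ) {s t : ℝ} (hs : 0 < s) (hst : s ≤ t) :
    LipschitzWith (max 1 (Real.toNNReal s⁻¹)) fun p : ℝ × ℝ => (p.2, -pull κ (p.1 / t)) := by
  have hdiv : LipschitzWith (Real.toNNReal s⁻¹) fun p : ℝ × ℝ => p.1 / t :=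
    LipschitzWith.of_dist_le_mul fun p q => by
      change |p.1 / t - q.1 / t| ≤ _
      rw [← sub_div, abs_div, abs_of_pos (hs.trans_le hst), div_eq_inv_mul,
        Real.coe_toNNReal _ (inv_nonneg.2 hs.le)]
      gcongr
      exact le_max_left _ _
  simpa using LipschitzWith.prod_snd.prodMk ((lipschitzWith_pull κ).comp hdiv).neg

theorem IsBranch.hasDerivWithinAt_prodMk {κ T : ℝ} {u v : ℝ → ℝ} (h : IsBranch κ T u v) {s : ℝ}
    (hs : s ∈ Ioc 0 T) :
    HasDerivWithinAt (fun t => (u t, v t)) (v s, -pull κ (u s / s)) (Ioc 0 T) s :=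
  (h.deriv_u s hs).prodMk (h.deriv_v s hs)

theorem IsBranch.eqOn {κ T : ℝ} {u₁ v₁ u₂ v₂ : ℝ → ℝ} (h₁ : IsBranch κ T u₁ v₁)
    (h₂ : IsBranch κ T u₂ v₂) (hu : u₁ T = u₂ T) (hv : v₁ T = v₂ T) {s : ℝ} (hs : s ∈ Ioc 0 T) :
    u₁ s = u₂ s ∧ v₁ s = v₂ s := by
  have hsub : Icc s T ⊆ Ioc 0 T := fun t ht => ⟨hs.1.trans_le ht.1, ht.2⟩
  have hcont {u v} (h : IsBranch κ T u v) : ContinuousOn (fun t => (u t, v t)) (Icc s T) :=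
    fun t ht => ((h.hasDerivWithinAt_prodMk (hsub ht)).continuousWithinAt).mono hsub
  have hderiv {u v} (h : IsBranch κ T u v) : ∀ t ∈ Ioc s T,
      HasDerivWithinAt (fun t => (u t, v t)) (v t, -pull κ (u t / t)) (Iic t) t := fun t ht =>
    (h.hasDerivWithinAt_prodMk (hsub (Ioc_subset_Icc_self ht))).mono_of_mem_nhdsWithin
      (Filter.mem_of_superset (Ioc_mem_nhdsLE (hs.1.trans ht.1)) (Ioc_subset_Ioc_right ht.2))
  have key := ODE_solution_unique_of_mem_Icc_left
    (v := fun t (p : ℝ × ℝ) => (p.2, -pull κ (p.1 / t))) (s := fun _ => univ)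
    (fun t ht => (lipschitzWith_branchField κ hs.1 ht.1.le).lipschitzOnWith)
    (hcont h₁) (hderiv h₁) (fun _ _ => mem_univ _) (hcont h₂) (hderiv h₂) (fun _ _ => mem_univ _)
    (Prod.ext hu hv) ⟨le_rfl, hs.2⟩
  exact Prod.mk_inj.1 key

theorem isBranch_profile (a T : ℝ) : IsBranch a T (primitive a) (profile a) where
  deriv_u s _ := (hasDerivAt_primitive a s).hasDerivWithinAt
  deriv_v _ hs := (hasDerivAt_profile a hs.1).hasDerivWithinAt

theorem isBranch_zero (κ T : ℝ) : IsBranch κ T (fun _ => 0) (fun _ => 0) where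
  deriv_u _ _ := hasDerivWithinAt_const _ _ _
  deriv_v _ _ := by simpa [pull_zero] using hasDerivWithinAt_const _ _ (0 : ℝ)

theorem profile_sq_add_primitive_sq_pos (a s : ℝ) : 0 < profile a s ^ 2 + primitive a s ^ 2 := by
  rcases le_or_gt s 0 with hs | hs
  · rw [profile_of_nonpos a hs]; positivity
  by_contra! hle
  have hu : primitive a s = 0 := by nlinarith [sq_nonneg (primitive a s), sq_nonneg (profile a s)]
  have hv : profile a s = 0 := by nlinarith [sq_nonneg (primitive a s), sq_nonneg (profile a s)]
  have hzero : ∀ t ∈ Ioc 0 s, profile a t = 0 := fun t ht =>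
    ((isBranch_profile a s).eqOn (isBranch_zero a s) hu hv ht).2
  have hlim : Tendsto (profile a) (𝓝[>] 0) (𝓝 0) := by
    refine tendsto_const_nhds.congr' ?_
    filter_upwards [Ioc_mem_nhdsGT hs] with t ht using (hzero t ht).symm
  have hlim' : Tendsto (profile a) (𝓝[>] 0) (𝓝 1) :=
    ((isVolterra_profile a).cont.tendsto' 0 1 (profile_zero a)).mono_left nhdsWithin_le_nhds
  exact zero_ne_one (tendsto_nhds_unique hlim hlim')

end Branch

section Shot

variable {a : ℝ} {u v : ℝ → ℝ}

theorem IsShot.isBranch (h : IsShot a u v) (T : ℝ) : IsBranch 1 T u v where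
  deriv_u s hs := (h.deriv_u s hs.1.le).mono fun _ hx => hx.1.le
  deriv_v s hs := by
    rw [pull_div hs.1]
    simpa using (h.deriv_v s hs.1).hasDerivWithinAt

theorem isVolterra_mul_profile (a : ℝ) :
    IsVolterra a (fun _ ρ => pull 1 ρ) (fun s => a * profile a s) where
  cont := by fun_prop
  eq_sub_integral s := by
    simp_rw [mean_const_mul, pull_one_mul, intervalIntegral.integral_const_mul,
      (isVolterra_profile a).eq_sub_integral s]
    ring

theorem isShot_profile (a : ℝ) :
    IsShot a (fun s => a * primitive a s) (fun s => a * profile a s) where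
  u_zero := by simp [primitive_zero]
  v_zero := by simp [profile_zero]
  deriv_u s _ := ((hasDerivAt_primitive a s).const_mul a).hasDerivWithinAt
  cont_v := (isVolterra_mul_profile a).cont.continuousOn
  deriv_v s hs := by
    refine ((hasDerivAt_profile a hs).const_mul a).congr_deriv ?_
    have := pull_div (κ := 1) hs (a * primitive a s)
    rw [mul_div_assoc, pull_one_mul, one_pow, one_mul] at this
    rw [mul_neg, this]

theorem IsShot.continuous_comp_max (h : IsShot a u v) : Continuous fun t => v (max t 0) :=
  h.cont_v.comp_continuous (by fun_prop) fun t => le_max_right t 0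

theorem IsShot.eq_mul_mean (h : IsShot a u v) {s : ℝ} (hs : 0 ≤ s) :
    u s = s * mean (fun t => v (max t 0)) s := by
  rw [← smul_eq_mul, smul_mean, intervalIntegral.integral_eq_sub_of_hasDerivAt_of_le hs (f := u),
    h.u_zero, sub_zero]
  · exact fun x hx => (h.deriv_u x hx.1).continuousWithinAt.mono fun _ hx => hx.1
  · intro x hx
    rw [max_eq_left hx.1.le]
    exact (h.deriv_u x hx.1.le).hasDerivAt (Ici_mem_nhds hx.1)
  · exact h.continuous_comp_max.intervalIntegrable _ _

theorem IsShot.isVolterra (h : IsShot a u v) :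
    IsVolterra a (fun _ ρ => pull 1 ρ) (fun t => v (max t 0)) where
  cont := h.continuous_comp_max
  eq_sub_integral s := by
    have hv := h.continuous_comp_max
    have hftc := intervalIntegral.integral_eq_sub_of_hasDerivAt_of_le (le_max_right s 0) (f := v)
      (f' := fun x => -pull 1 (mean (fun t => v (max t 0)) x)) (h.cont_v.mono fun _ hx => hx.1)
      (fun x hx => ?_)
      ((continuous_comp_mean (by fun_prop) hv).neg.intervalIntegrable _ _)
    · rw [intervalIntegral.integral_neg, h.v_zero] at hftc
      linarith
    · have hderiv := h.deriv_v x hx.1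
      have hpull := pull_div (κ := 1) hx.1 (u x)
      rw [one_pow, one_mul, h.eq_mul_mean hx.1.le, mul_div_cancel_left₀ _ hx.1.ne',
        ← h.eq_mul_mean hx.1.le] at hpull
      rwa [hpull]

theorem IsShot.eq_profile (h : IsShot a u v) {s : ℝ} (hs : 0 ≤ s) :
    u s = a * primitive a s ∧ v s = a * profile a s := by
  have heq := h.isVolterra.unique (isVolterra_mul_profile a) (by fun_prop)
    fun _ => lipschitzWith_pull 1
  refine ⟨?_, by simpa [hs] using congrFun heq s⟩
  rw [h.eq_mul_mean hs, heq, mean_const_mul, primitive, mul_left_comm]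

end Shot

section Oscillation

theorem sub_le_sub_of_hasDerivAt_le {f g f' g' : ℝ → ℝ} {a b : ℝ} (hab : a ≤ b)
    (hf : ∀ x ∈ Icc a b, HasDerivAt f (f' x) x) (hg : ∀ x ∈ Icc a b, HasDerivAt g (g' x) x)
    (h : ∀ x ∈ Icc a b, f' x ≤ g' x) : f b - f a ≤ g b - g a := by
  have hmono : MonotoneOn (fun x => g x - f x) (Icc a b) :=
    monotoneOn_of_hasDerivWithinAt_nonneg (convex_Icc a b) (f' := fun x => g' x - f' x)
      (fun x hx => ((hg x hx).sub (hf x hx)).continuousAt.continuousWithinAt)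
      (fun x hx => ((hg x (interior_subset hx)).sub (hf x (interior_subset hx))).hasDerivWithinAt)
      fun x hx => sub_nonneg.2 (h x (interior_subset hx))
  linarith [hmono (left_mem_Icc.2 hab) (right_mem_Icc.2 hab) hab]

variable {κ s₁ : ℝ} {u v : ℝ → ℝ}

/-- While `u` increases, `v' = -pull κ (u / s)` is at most a negative multiple of `1 / s`, so `v`
decreases at least logarithmically. -/
theorem exists_nonpos_of_pos (hs₁ : 0 < s₁) (hu : ∀ s ∈ Ici s₁, HasDerivAt u (v s) s)
    (hv : ∀ s ∈ Ici s₁, HasDerivAt v (-pull κ (u s / s)) s) (hpos : 0 < u s₁) :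
    ∃ s ∈ Ici s₁, v s ≤ 0 := by
  by_contra! hvpos
  have humono : ∀ s ∈ Ici s₁, u s₁ ≤ u s := fun s hs => by
    have := sub_le_sub_of_hasDerivAt_le hs (fun x _ => hasDerivAt_const x (0 : ℝ))
      (fun x hx => hu x hx.1) fun x hx => (hvpos x hx.1).le
    linarith
  set k := s₁ * pull κ (u s₁ / s₁) with hk
  have hk0 : 0 < k := mul_pos hs₁ (pull_pos (div_pos hpos hs₁))
  have hpull : ∀ s ∈ Ici s₁, -pull κ (u s / s) ≤ -k * s⁻¹ := fun s hs => by
    have hs0 : 0 < s := hs₁.trans_le hs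
    rw [neg_mul, neg_le_neg_iff]
    calc k * s⁻¹ = s₁ / s * pull κ (u s₁ / s₁) := by rw [hk]; ring
      _ ≤ pull κ (s₁ / s * (u s₁ / s₁)) :=
          mul_pull_le_pull_mul ⟨by positivity, (div_le_one hs0).2 hs⟩ (by positivity)
      _ = pull κ (u s₁ / s) := by rw [mul_comm, div_mul_div_cancel₀ hs₁.ne']
      _ ≤ pull κ (u s / s) := monotone_pull κ (by gcongr; exact humono s hs)
  set s₂ := s₁ * Real.exp (v s₁ / k) with hs₂
  have h12 : s₁ ≤ s₂ := le_mul_of_one_le_right hs₁.le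
    (Real.one_le_exp (div_nonneg (hvpos s₁ self_mem_Ici).le hk0.le))
  have hlog := sub_le_sub_of_hasDerivAt_le h12 (fun x hx => hv x hx.1)
    (fun x hx => (Real.hasDerivAt_log (hs₁.trans_le hx.1).ne').const_mul (-k))
    fun x hx => hpull x hx.1
  rw [← mul_sub, hs₂, Real.log_mul hs₁.ne' (Real.exp_pos _).ne', Real.log_exp, add_sub_cancel_left,
    neg_mul, mul_div_cancel₀ _ hk0.ne', ← hs₂] at hlog
  linarith [hvpos s₂ h12]

theorem exists_pos_of_forall_pos (hs₁ : 0 < s₁) (hu : ∀ s ∈ Ici s₁, HasDerivAt u (v s) s)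
    (hv : ∀ s ∈ Ici s₁, HasDerivAt v (-pull κ (u s / s)) s) (hpos : ∀ s ∈ Ici s₁, 0 < v s) :
    ∃ s ∈ Ici s₁, 0 < u s := by
  by_contra! hneg
  have hvmono : ∀ s ∈ Ici s₁, v s₁ ≤ v s := fun s hs => by
    have := sub_le_sub_of_hasDerivAt_le hs (fun x _ => hasDerivAt_const x (0 : ℝ))
      (fun x hx => hv x hx.1) fun x hx => by
        rw [← pull_neg, ← neg_div, ← pull_zero κ]
        exact monotone_pull κ
          (div_nonneg (neg_nonneg.2 (hneg x hx.1)) (hs₁.le.trans hx.1))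
    linarith
  have hv₁ := hpos s₁ self_mem_Ici
  set s₂ := s₁ + (1 - u s₁) / v s₁ with hs₂
  have h12 : s₁ ≤ s₂ :=
    le_add_of_nonneg_right (div_nonneg (by linarith [hneg s₁ self_mem_Ici]) hv₁.le)
  have hgrowth := sub_le_sub_of_hasDerivAt_le h12
    (fun x _ => (hasDerivAt_id' x).const_mul (v s₁)) (fun x hx => hu x hx.1)
    fun x hx => by simpa using hvmono x hx.1
  rw [← mul_sub, hs₂, add_sub_cancel_left, mul_div_cancel₀ _ hv₁.ne', ← hs₂] at hgrowth
  linarith [hneg s₂ h12]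

theorem exists_nonpos (hs₁ : 0 < s₁) (hu : ∀ s ∈ Ici s₁, HasDerivAt u (v s) s)
    (hv : ∀ s ∈ Ici s₁, HasDerivAt v (-pull κ (u s / s)) s) : ∃ s ∈ Ici s₁, v s ≤ 0 := by
  by_contra! hpos
  obtain ⟨s₂, h12, hu₂⟩ := exists_pos_of_forall_pos hs₁ hu hv hpos
  have hsub : Ici s₂ ⊆ Ici s₁ := Ici_subset_Ici.2 h12
  obtain ⟨s, hs, hvs⟩ := exists_nonpos_of_pos (hs₁.trans_le h12) (fun s hs => hu s (hsub hs))
    (fun s hs => hv s (hsub hs)) hu₂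
  exact hvs.not_gt (hpos s (hsub hs))

theorem exists_profile_eq_zero (a S : ℝ) : ∃ s > S, profile a s = 0 := by
  set s₁ := max S 0 + 1
  have hs₁ : 0 < s₁ := by positivity
  have hS : S < s₁ := by linarith [le_max_left S 0]
  have hv : ∀ s ∈ Ici s₁, HasDerivAt (profile a) (-pull a (primitive a s / s)) s := fun s hs =>
    hasDerivAt_profile a (hs₁.trans_le hs)
  obtain ⟨x, hx, hx0⟩ := exists_nonpos hs₁ (fun s _ => hasDerivAt_primitive a s) hv
  obtain ⟨y, hy, hy0⟩ := exists_nonpos (v := fun s => -profile a s) hs₁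
    (fun s _ => (hasDerivAt_primitive a s).neg)
    fun s hs => (hv s hs).neg.congr_deriv (by rw [Pi.neg_apply, neg_div, pull_neg])
  obtain ⟨z, hz, hz0⟩ := isPreconnected_Ici.intermediate_value hx hy
    (isVolterra_profile a).cont.continuousOn ⟨hx0, neg_nonpos.1 hy0⟩
  exact ⟨z, hS.trans_le hz, hz0⟩

end Oscillation

section PhaseAngle

theorem eq_mul_exp_integral_of_hasDerivWithinAt {z g : ℝ → ℂ} {s : ℝ} (hs : 0 ≤ s)
    (hg : Continuous g) (hz : ∀ t, 0 ≤ t → HasDerivWithinAt z (g t * z t) (Ici 0) t) :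
    z s = z 0 * Complex.exp (∫ t in (0 : ℝ)..s, g t) := by
  set w : ℝ → ℂ := fun t => z t * Complex.exp (-∫ x in (0 : ℝ)..t, g x)
  have hw : ∀ t, 0 ≤ t → HasDerivWithinAt w 0 (Ici 0) t := fun t ht =>
    ((hz t ht).mul
      (hg.integral_hasStrictDerivAt 0 t).hasDerivAt.neg.cexp.hasDerivWithinAt).congr_deriv (by ring)
  have hconst : w s = w 0 := constant_of_has_deriv_right_zero
    (fun t ht => (hw t ht.1).continuousWithinAt.mono fun _ hx => hx.1)
    (fun t ht => (hw t ht.1).mono (Ici_subset_Ici.2 ht.1)) s ⟨hs, le_rfl⟩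
  simp only [w, intervalIntegral.integral_same, neg_zero, Complex.exp_zero, mul_one] at hconst
  rw [← hconst, mul_assoc, ← Complex.exp_add, neg_add_cancel, Complex.exp_zero, mul_one]

/-- The phase-plane curve of the profile, as a complex number. -/
noncomputable def phase (a s : ℝ) : ℂ := ⟨profile a s, primitive a s⟩

theorem phase_ne_zero (a s : ℝ) : phase a s ≠ 0 := fun h => by
  have := profile_sq_add_primitive_sq_pos a s
  rw [show profile a s = 0 from congrArg Complex.re h,
    show primitive a s = 0 from congrArg Complex.im h] at this
  simp at this

/-- The logarithmic derivative of `phase`. -/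
noncomputable def phaseRate (a s : ℝ) : ℂ := ⟨-pull a (mean (profile a) s), profile a s⟩ / phase a s

theorem continuous_phaseRate : Continuous fun p : ℝ × ℝ => phaseRate p.1 p.2 := by
  have hmk {f g : ℝ × ℝ → ℝ} (hf : Continuous f) (hg : Continuous g) :
      Continuous fun p => (⟨f p, g p⟩ : ℂ) :=
    Complex.equivRealProdCLM.symm.continuous.comp (hf.prodMk hg)
  exact (hmk (by fun_prop) (by fun_prop)).div (hmk (by fun_prop) (by fun_prop))
    fun p => phase_ne_zero p.1 p.2

theorem hasDerivWithinAt_phase (a : ℝ) {s : ℝ} (hs : 0 ≤ s) :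
    HasDerivWithinAt (phase a) (phaseRate a s * phase a s) (Ici 0) s := by
  rw [phaseRate, div_mul_cancel₀ _ (phase_ne_zero a s)]
  exact Complex.equivRealProdCLM.symm.hasFDerivAt.comp_hasDerivWithinAt s
    ((hasDerivWithinAt_profile a hs).prodMk (hasDerivAt_primitive a s).hasDerivWithinAt)

/-- The continuous determination of the argument of `phase` that vanishes at `s = 0`. -/
noncomputable def angle (a s : ℝ) : ℝ := (∫ t in (0 : ℝ)..s, phaseRate a t).im

@[fun_prop]
theorem continuous_angle {X : Type*} [TopologicalSpace X] {a s : X → ℝ} (ha : Continuous a)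
    (hs : Continuous s) : Continuous fun x => angle (a x) (s x) := by
  have hint := intervalIntegral.continuous_parametric_primitive_of_continuous (a₀ := 0)
    (μ := MeasureTheory.volume) (f := phaseRate) continuous_phaseRate
  exact (Complex.continuous_im.comp hint).comp₂ ha hs

theorem exists_polar (a : ℝ) {s : ℝ} (hs : 0 ≤ s) :
    ∃ c > 0, profile a s = c * Real.cos (angle a s) ∧ primitive a s = c * Real.sin (angle a s) := by
  have hexp := eq_mul_exp_integral_of_hasDerivWithinAt hs
    (continuous_phaseRate.comp (by fun_prop : Continuous fun t : ℝ => (a, t)))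
    fun t ht => hasDerivWithinAt_phase a ht
  have hzero : phase a 0 = 1 := by
    rw [phase, profile_zero, primitive_zero]
    rfl
  rw [hzero, one_mul] at hexp
  exact ⟨_, Real.exp_pos _, (congrArg Complex.re hexp).trans (Complex.exp_re _),
    (congrArg Complex.im hexp).trans (Complex.exp_im _)⟩

theorem angle_zero (a : ℝ) : angle a 0 = 0 := by
  rw [angle, intervalIntegral.integral_same, Complex.zero_im]

theorem hasDerivAt_angle (a s : ℝ) : HasDerivAt (angle a) (phaseRate a s).im s :=
  Complex.imCLM.hasFDerivAt.comp_hasDerivAt s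
    ((continuous_phaseRate.comp
      (by fun_prop : Continuous fun t : ℝ => (a, t))).integral_hasStrictDerivAt 0 s).hasDerivAt

theorem phaseRate_im_pos (a : ℝ) {s : ℝ} (hs : 0 < s) : 0 < (phaseRate a s).im := by
  have hnorm := profile_sq_add_primitive_sq_pos a s
  have him : (phaseRate a s).im = (profile a s ^ 2 +
      s * mean (profile a) s ^ 2 * Real.cos (Real.arctan (a * mean (profile a) s))) /
      (profile a s ^ 2 + primitive a s ^ 2) := by
    rw [phaseRate, Complex.div_im, Complex.normSq_apply, phase, ← sub_div]
    simp only [primitive, pull]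
    ring
  have := Real.cos_arctan_pos (a * mean (profile a) s)
  rw [him]
  refine div_pos ?_ hnorm
  rcases eq_or_ne (profile a s) 0 with hzero | hzero
  · have : mean (profile a) s ≠ 0 := fun hmean => by simp [hzero, primitive, hmean] at hnorm
    positivity
  · positivity

theorem strictMonoOn_angle (a : ℝ) : StrictMonoOn (angle a) (Ici 0) := by
  refine strictMonoOn_of_hasDerivWithinAt_pos (convex_Ici 0)
    (fun s _ => (hasDerivAt_angle a s).continuousAt.continuousWithinAt)
    (fun s _ => (hasDerivAt_angle a s).hasDerivWithinAt) fun s hs => ?_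
  rw [interior_Ici] at hs
  exact phaseRate_im_pos a hs

theorem angle_pos (a : ℝ) {s : ℝ} (hs : 0 < s) : 0 < angle a s := by
  rw [← angle_zero a]
  exact strictMonoOn_angle a self_mem_Ici hs.le hs

theorem profile_eq_zero_iff_angle (a : ℝ) {s : ℝ} (hs : 0 < s) :
    profile a s = 0 ↔ ∃ n : ℕ, angle a s = (n + 1 / 2) * Real.pi := by
  obtain ⟨c, hc, hprofile, _⟩ := exists_polar a hs.le
  rw [hprofile, mul_eq_zero, or_iff_right hc.ne', Real.cos_eq_zero_iff]
  constructor
  · rintro ⟨k, hk⟩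
    have hk0 : 0 ≤ k := by
      by_contra! hneg
      have hk1 : (k : ℝ) ≤ -1 := by exact_mod_cast Int.le_sub_one_of_lt hneg
      have := angle_pos a hs
      rw [hk] at this
      nlinarith [Real.pi_pos]
    lift k to ℕ using hk0
    exact ⟨k, by rw [hk]; push_cast; ring⟩
  · rintro ⟨n, hn⟩
    exact ⟨n, by rw [hn]; push_cast; ring⟩

theorem exists_le_angle (a : ℝ) (n : ℕ) : ∃ s, 0 ≤ s ∧ (n - 1 / 2) * Real.pi ≤ angle a s := by
  induction n with
  | zero => exact ⟨0, le_rfl, by rw [angle_zero]; push_cast; linarith [Real.pi_pos]⟩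
  | succ n ih =>
    obtain ⟨t, ht, hle⟩ := ih
    obtain ⟨s, hts, hzero⟩ := exists_profile_eq_zero a t
    have hs : 0 < s := ht.trans_lt hts
    obtain ⟨k, hk⟩ := (profile_eq_zero_iff_angle a hs).1 hzero
    have hlt := hle.trans_lt (strictMonoOn_angle a ht hs.le hts)
    rw [hk] at hlt
    have hnk : (n : ℝ) < (k + 1 : ℕ) := by
      push_cast
      linarith [lt_of_mul_lt_mul_right hlt Real.pi_pos.le]
    have hnk' : (n : ℝ) ≤ k := by exact_mod_cast Nat.lt_succ_iff.1 (by exact_mod_cast hnk)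
    refine ⟨s, hs.le, ?_⟩
    rw [hk]
    push_cast
    gcongr
    linarith

theorem surjOn_angle (a : ℝ) : SurjOn (angle a) (Ici 0) (Ici 0) := by
  intro θ hθ
  obtain ⟨n, hn⟩ := exists_nat_gt (θ / Real.pi + 1 / 2)
  obtain ⟨S, hS, hle⟩ := exists_le_angle a n
  have hθS : θ ≤ angle a S := by
    rw [← lt_sub_iff_add_lt, div_lt_iff₀ Real.pi_pos] at hn
    exact hn.le.trans hle
  obtain ⟨s, hs, hθs⟩ := intermediate_value_Icc hS (f := angle a)
    (by fun_prop : Continuous (angle a)).continuousOn ⟨(angle_zero a).trans_le hθ, hθS⟩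
  exact ⟨s, hs.1, hθs⟩

/-- The time at which the phase angle takes the value `θ ≥ 0`. -/
noncomputable def angleInv (θ a : ℝ) : ℝ := Function.invFunOn (angle a) (Ici 0) θ

variable {θ θ' : ℝ}

theorem angleInv_nonneg (hθ : 0 ≤ θ) (a : ℝ) : 0 ≤ angleInv θ a :=
  Function.invFunOn_mem (surjOn_angle a hθ)

theorem angle_angleInv (hθ : 0 ≤ θ) (a : ℝ) : angle a (angleInv θ a) = θ :=
  Function.invFunOn_eq (surjOn_angle a hθ)

theorem lt_angleInv_iff (hθ : 0 ≤ θ) (a : ℝ) {s : ℝ} (hs : 0 ≤ s) :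
    s < angleInv θ a ↔ angle a s < θ := by
  rw [← (strictMonoOn_angle a).lt_iff_lt hs (angleInv_nonneg hθ a), angle_angleInv hθ]

theorem angleInv_lt_iff (hθ : 0 ≤ θ) (a : ℝ) {s : ℝ} (hs : 0 ≤ s) :
    angleInv θ a < s ↔ θ < angle a s := by
  rw [← (strictMonoOn_angle a).lt_iff_lt (angleInv_nonneg hθ a) hs, angle_angleInv hθ]

theorem angleInv_eq_iff (hθ : 0 ≤ θ) (a : ℝ) {s : ℝ} (hs : 0 ≤ s) :
    angleInv θ a = s ↔ angle a s = θ := by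
  rw [← (strictMonoOn_angle a).injOn.eq_iff (angleInv_nonneg hθ a) hs, angle_angleInv hθ, eq_comm]

theorem angleInv_zero (a : ℝ) : angleInv 0 a = 0 :=
  (angleInv_eq_iff le_rfl a le_rfl).2 (angle_zero a)

theorem strictMonoOn_angleInv (a : ℝ) : StrictMonoOn (fun θ => angleInv θ a) (Ici 0) :=
  fun θ hθ θ' hθ' h => by
    change angleInv θ a < angleInv θ' a
    rwa [lt_angleInv_iff hθ' a (angleInv_nonneg hθ a), angle_angleInv hθ]

theorem angleInv_pos (hθ : 0 < θ) (a : ℝ) : 0 < angleInv θ a :=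
  (lt_angleInv_iff hθ.le a le_rfl).2 (by rwa [angle_zero])

theorem continuous_angleInv (hθ : 0 ≤ θ) : Continuous (angleInv θ) := by
  have hangle : ∀ s, Continuous fun a => angle a s := fun s => by fun_prop
  refine continuous_iff_continuousAt.2 fun a => tendsto_order.2 ⟨fun s hs => ?_, fun s hs => ?_⟩
  · rcases lt_or_ge s 0 with hneg | hs0
    · exact .of_forall fun b => hneg.trans_le (angleInv_nonneg hθ b)
    · filter_upwards [(hangle s).continuousAt.eventually_lt_const
        ((lt_angleInv_iff hθ a hs0).1 hs)] with b hb using (lt_angleInv_iff hθ b hs0).2 hb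
  · have hs0 : 0 ≤ s := (angleInv_nonneg hθ a).trans hs.le
    filter_upwards [(hangle s).continuousAt.eventually_const_lt
      ((angleInv_lt_iff hθ a hs0).1 hs)] with b hb using (angleInv_lt_iff hθ b hs0).2 hb

end PhaseAngle

section ProfileZero

/-- The `n`-th positive zero of the profile, counted from `n = 0`. -/
noncomputable def profileZero (n : ℕ) (a : ℝ) : ℝ := angleInv ((n + 1 / 2) * Real.pi) a

theorem add_half_mul_pi_pos (n : ℕ) : 0 < ((n : ℝ) + 1 / 2) * Real.pi :=
  mul_pos (by positivity) Real.pi_pos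

theorem profileZero_pos (n : ℕ) (a : ℝ) : 0 < profileZero n a :=
  angleInv_pos (add_half_mul_pi_pos n) a

theorem continuous_profileZero (n : ℕ) : Continuous (profileZero n) :=
  continuous_angleInv (add_half_mul_pi_pos n).le

theorem strictMono_profileZero (a : ℝ) : StrictMono fun n => profileZero n a := fun m n hmn =>
  strictMonoOn_angleInv a (add_half_mul_pi_pos m).le (add_half_mul_pi_pos n).le
    (mul_lt_mul_of_pos_right (by gcongr) Real.pi_pos)

theorem profile_eq_zero_iff (a : ℝ) {s : ℝ} (hs : 0 < s) :
    profile a s = 0 ↔ ∃ n, profileZero n a = s := by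
  rw [profile_eq_zero_iff_angle a hs]
  exact exists_congr fun n => (angleInv_eq_iff (add_half_mul_pi_pos n).le a hs.le).symm

theorem profile_profileZero (n : ℕ) (a : ℝ) : profile a (profileZero n a) = 0 :=
  (profile_eq_zero_iff a (profileZero_pos n a)).2 ⟨n, rfl⟩

theorem encard_profile_zeros (a s : ℝ) :
    {x ∈ Ioo 0 s | profile a x = 0}.encard = {n | profileZero n a < s}.encard := by
  rw [← (strictMono_profileZero a).injective.encard_image]
  congr 1
  ext x
  constructor
  · rintro ⟨⟨hx, hxs⟩, hzero⟩
    obtain ⟨n, rfl⟩ := (profile_eq_zero_iff a hx).1 hzero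
    exact ⟨n, hxs, rfl⟩
  · rintro ⟨n, hn, rfl⟩
    exact ⟨⟨profileZero_pos n a, hn⟩, profile_profileZero n a⟩

theorem encard_Iio_nat (n : ℕ) : (Iio n).encard = n := by
  rw [← Finset.coe_Iio, encard_coe_eq_coe_finsetCard, Nat.card_Iio]

theorem encard_profile_zeros_le_iff (a s : ℝ) (n : ℕ) :
    {x ∈ Ioo 0 s | profile a x = 0}.encard ≤ n ↔ s ≤ profileZero n a := by
  rw [encard_profile_zeros]
  constructor
  · intro hle
    by_contra! hlt
    have hsub : Iio (n + 1) ⊆ {m | profileZero m a < s} := fun m hm =>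
      ((strictMono_profileZero a).monotone (Nat.lt_succ_iff.1 hm)).trans_lt hlt
    have := (encard_le_encard hsub).trans hle
    rw [encard_Iio_nat, Nat.cast_le] at this
    omega
  · intro hle
    have hsub : {m | profileZero m a < s} ⊆ Iio n := fun m hm =>
      (strictMono_profileZero a).lt_iff_lt.1 (hm.trans_le hle)
    exact (encard_le_encard hsub).trans (encard_Iio_nat n).le

theorem encard_profile_zeros_profileZero (a : ℝ) (n : ℕ) :
    {x ∈ Ioo 0 (profileZero n a) | profile a x = 0}.encard = n := by
  simp only [encard_profile_zeros, (strictMono_profileZero a).lt_iff_lt]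
  exact encard_Iio_nat n

theorem isNthZero_profile_iff (a s : ℝ) (n : ℕ) :
    IsNthZero (profile a) (n + 1) s ↔ s = profileZero n a := by
  constructor
  · rintro ⟨hs, hzero, hcard⟩
    obtain ⟨m, rfl⟩ := (profile_eq_zero_iff a hs).1 hzero
    rw [encard_profile_zeros_profileZero] at hcard
    rw [Nat.succ_injective (by exact_mod_cast hcard : m + 1 = n + 1)]
  · rintro rfl
    refine ⟨profileZero_pos n a, profile_profileZero n a, ?_⟩
    rw [encard_profile_zeros_profileZero]
    norm_cast

end ProfileZero

section SignLemmas

variable {f : ℝ → ℝ} {a b d : ℝ}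

theorem exists_first_zero (hab : a ≤ b) (hf : ContinuousOn f (Icc a b)) (ha : 0 < f a)
    (hb : f b ≤ 0) : ∃ t ∈ Ioc a b, f t = 0 ∧ ∀ x ∈ Ico a t, 0 < f x := by
  have hzero : ∀ x ∈ Icc a b, f x ≤ 0 → ∃ z ∈ Icc a x, f z = 0 := fun x hx hfx =>
    intermediate_value_Icc' hx.1 (hf.mono (Icc_subset_Icc_right hx.2)) ⟨hfx, ha.le⟩
  have hcompact : IsCompact (Icc a b ∩ f ⁻¹' {0}) :=
    isCompact_Icc.of_isClosed_subset
      (hf.preimage_isClosed_of_isClosed isClosed_Icc isClosed_singleton) inter_subset_left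
  obtain ⟨z, hz, hz0⟩ := hzero b (right_mem_Icc.2 hab) hb
  obtain ⟨t, ⟨ht, ht0⟩, hleast⟩ := hcompact.exists_isLeast ⟨z, hz, hz0⟩
  have hat : a ≠ t := fun h => ha.ne' (h ▸ ht0)
  refine ⟨t, ⟨ht.1.lt_of_ne hat, ht.2⟩, ht0, fun x hx => ?_⟩
  by_contra! hfx
  obtain ⟨y, hy, hy0⟩ := hzero x ⟨hx.1, hx.2.le.trans ht.2⟩ hfx
  exact (hleast ⟨⟨hy.1, hy.2.trans (hx.2.le.trans ht.2)⟩, hy0⟩).not_gt (hy.2.trans_lt hx.2)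

theorem eventually_sign_eq_of_hasDerivAt_pos (hd : HasDerivAt f d a) (hd0 : 0 < d)
    (ha : f a = 0) : ∀ᶠ x in 𝓝 a, SignType.sign (f x) = SignType.sign (x - a) :=
  eventually_nhdsWithin_sign_eq_of_deriv_pos (by rwa [hd.deriv]) ha

theorem nonpos_of_hasDerivAt_of_pos_left (hab : a < b) (hd : HasDerivAt f d b)
    (hpos : ∀ x ∈ Ioo a b, 0 < f x) (hb : f b = 0) : d ≤ 0 := by
  by_contra! hd0
  have hleft := (eventually_sign_eq_of_hasDerivAt_pos hd hd0 hb).filter_mono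
    (nhdsWithin_le_nhds (s := Iio b))
  obtain ⟨x, hsign, hx⟩ := (hleft.and (Ioo_mem_nhdsLT hab)).exists
  rw [sign_pos (hpos x hx), sign_neg (sub_neg.2 hx.2)] at hsign
  exact absurd hsign (by decide)

theorem pos_of_forall_ne_zero (hf : ContinuousOn f (Icc a b)) (ha : f a = 0)
    (hd : HasDerivAt f d a) (hd0 : 0 < d)
    (hne : ∀ t ∈ Ioc a b, (∀ x ∈ Ioo a t, 0 < f x) → f t ≠ 0) : ∀ t ∈ Ioc a b, 0 < f t := by
  have hright : ∀ᶠ x in 𝓝[>] a, 0 < f x := by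
    filter_upwards [nhdsWithin_le_nhds (eventually_sign_eq_of_hasDerivAt_pos hd hd0 ha),
      self_mem_nhdsWithin] with x hx hax
    rwa [sign_pos (sub_pos.2 hax), sign_eq_one_iff] at hx
  obtain ⟨c, hac, hc⟩ := mem_nhdsGT_iff_exists_Ioc_subset.1 hright
  intro t ht
  by_contra! hft
  have hct : c < t := lt_of_not_ge fun htc => hft.not_gt (hc ⟨ht.1, htc⟩)
  obtain ⟨x, hx, hx0, hpos⟩ := exists_first_zero hct.le
    (hf.mono (Icc_subset_Icc (le_of_lt hac) ht.2)) (hc ⟨hac, le_rfl⟩) hft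
  refine hne x ⟨hac.trans hx.1, hx.2.trans ht.2⟩ (fun y hy => ?_) hx0
  rcases le_or_gt y c with hyc | hcy
  · exact hc ⟨hy.1, hyc⟩
  · exact hpos y ⟨hcy.le, hy.2⟩

theorem tendsto_div_nhdsGT_zero (hd : HasDerivAt f d 0) (h0 : f 0 = 0) :
    Tendsto (fun s => f s / s) (𝓝[>] 0) (𝓝 d) :=
  hd.tendsto_slope_zero_right.congr fun s => by
    rw [zero_add, h0, sub_zero, smul_eq_mul, inv_mul_eq_div]

end SignLemmas

section Variation

theorem mul_cos_arctan_pow_three_lt_pull {κ ρ : ℝ} (hκ : κ ≠ 0) (hρ : 0 < ρ) :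
    ρ * Real.cos (Real.arctan (κ * ρ)) ^ 3 < pull κ ρ := by
  have hpos := Real.cos_arctan_pos (κ * ρ)
  have hsq : Real.cos (Real.arctan (κ * ρ)) ^ 2 < 1 := by
    rw [Real.cos_sq_arctan]
    exact (div_lt_one (by positivity)).2 (by linarith [sq_pos_of_ne_zero (mul_ne_zero hκ hρ.ne')])
  exact mul_lt_mul_of_pos_left
    (pow_lt_self_of_lt_one₀ hpos ((sq_lt_one_iff₀ hpos.le).1 hsq) (by norm_num)) hρ

/-- The height at which the tangent to the graph of `u` (with `v = u'`) at `s` meets the vertical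
axis. -/
def tangentIntercept (u v : ℝ → ℝ) (s : ℝ) : ℝ := u s - s * v s

/-- The Wronskian of `u` and `w`, where `v = u'` and `o = w'`. -/
def wronskian (u v w o : ℝ → ℝ) (s : ℝ) : ℝ := w s * v s - o s * u s

/-- The Wronskian `w y' - w' y` of `w` and `y = (u - s u') / √s`, with `o = w'` and with the
derivative of `u' = v` replaced by its value `-pull κ (u / s)`. The power of `s` is chosen so that
the derivative of the Wronskian contains no first derivatives of `u - s u'` and `w`. -/
noncomputable def radialWronskian (κ : ℝ) (u v w o : ℝ → ℝ) (s : ℝ) : ℝ :=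
  (w s * s * pull κ (u s / s) - w s * tangentIntercept u v s / (2 * s) -
    o s * tangentIntercept u v s) / √s

/-- On `(0, ∞)`, `u` solves the shape equation `u'' = -pull κ (u / s)` and `w` its linearisation at
`u`; moreover `v = u'` and `o = w'` are continuous on `ℝ`. -/
structure IsVariation (κ : ℝ) (u v w o : ℝ → ℝ) : Prop where
  deriv_u : ∀ s, HasDerivAt u (v s) s
  cont_v : Continuous v
  deriv_v : ∀ s, 0 < s → HasDerivAt v (-pull κ (u s / s)) s
  deriv_w : ∀ s, HasDerivAt w (o s) s
  cont_o : Continuous o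
  deriv_o : ∀ s, 0 < s → HasDerivAt o (-(Real.cos (Real.arctan (κ * (u s / s))) ^ 3 * (w s / s))) s

namespace IsVariation

variable {κ s α β : ℝ} {u v w o : ℝ → ℝ}

theorem neg (h : IsVariation κ u v w o) : IsVariation κ (-u) (-v) (-w) (-o) where
  deriv_u s := (h.deriv_u s).neg
  cont_v := h.cont_v.neg
  deriv_v s hs := (h.deriv_v s hs).neg.congr_deriv (by rw [Pi.neg_apply, neg_div, pull_neg])
  deriv_w s := (h.deriv_w s).neg
  cont_o := h.cont_o.neg
  deriv_o s hs := (h.deriv_o s hs).neg.congr_deriv (by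
    simp only [Pi.neg_apply, neg_div, mul_neg, Real.arctan_neg, Real.cos_neg])

theorem neg_one_pow_smul (h : IsVariation κ u v w o) (n : ℕ) :
    IsVariation κ ((-1 : ℝ) ^ n • u) ((-1 : ℝ) ^ n • v) ((-1 : ℝ) ^ n • w) ((-1 : ℝ) ^ n • o) := by
  rcases neg_one_pow_eq_or ℝ n with hn | hn
  · simpa only [hn, one_smul] using h
  · simpa only [hn, neg_one_smul] using h.neg

theorem radialWronskian_neg_one_pow_smul (n : ℕ) :
    radialWronskian κ ((-1 : ℝ) ^ n • u) ((-1 : ℝ) ^ n • v) ((-1 : ℝ) ^ n • w) ((-1 : ℝ) ^ n • o) =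
      radialWronskian κ u v w o := by
  funext s
  rcases neg_one_pow_eq_or ℝ n with hn | hn
  · simp only [hn, one_smul]
  · simp only [hn, neg_one_smul, radialWronskian, tangentIntercept, Pi.neg_apply, neg_div, pull_neg]
    ring

theorem continuous_u (h : IsVariation κ u v w o) : Continuous u :=
  continuous_iff_continuousAt.2 fun s => (h.deriv_u s).continuousAt

theorem continuous_w (h : IsVariation κ u v w o) : Continuous w :=
  continuous_iff_continuousAt.2 fun s => (h.deriv_w s).continuousAt

theorem continuous_tangentIntercept (h : IsVariation κ u v w o) :
    Continuous (tangentIntercept u v) :=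
  h.continuous_u.sub (continuous_id.mul h.cont_v)

theorem continuous_wronskian (h : IsVariation κ u v w o) : Continuous (wronskian u v w o) :=
  (h.continuous_w.mul h.cont_v).sub (h.cont_o.mul h.continuous_u)

theorem hasDerivAt_tangentIntercept (h : IsVariation κ u v w o) (hs : 0 < s) :
    HasDerivAt (tangentIntercept u v) (s * pull κ (u s / s)) s :=
  ((h.deriv_u s).sub ((hasDerivAt_id' s).mul (h.deriv_v s hs))).congr_deriv (by ring)

theorem hasDerivAt_wronskian (h : IsVariation κ u v w o) (hs : 0 < s) :
    HasDerivAt (wronskian u v w o) (-(w s * (pull κ (u s / s) -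
      u s / s * Real.cos (Real.arctan (κ * (u s / s))) ^ 3))) s :=
  (((h.deriv_w s).mul (h.deriv_v s hs)).sub
    ((h.deriv_o s hs).mul (h.deriv_u s))).congr_deriv (by ring)

theorem hasDerivAt_radialWronskian (h : IsVariation κ u v w o) (hs : 0 < s) :
    HasDerivAt (radialWronskian κ u v w o)
      (3 / 4 * (w s * tangentIntercept u v s) / (s ^ 2 * √s)) s := by
  have hpull : HasDerivAt (fun s => pull κ (u s / s))
      (Real.cos (Real.arctan (κ * (u s / s))) ^ 3 * ((v s * s - u s * 1) / s ^ 2)) s :=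
    (hasDerivAt_pull κ (u s / s)).comp (h := fun s => u s / s) s
      ((h.deriv_u s).div (hasDerivAt_id' s) hs.ne')
  have hz := h.hasDerivAt_tangentIntercept hs
  have hw := h.deriv_w s
  have hsqrt : 0 < √s := Real.sqrt_pos.2 hs
  refine (((((hw.mul (hasDerivAt_id' s)).mul hpull).sub
    ((hw.mul hz).div ((hasDerivAt_id' s).const_mul 2) (by positivity))).sub
    ((h.deriv_o s hs).mul hz)).div (Real.hasDerivAt_sqrt hs.ne') hsqrt.ne').congr_deriv ?_
  have hsq : √s ^ 2 = s := Real.sq_sqrt hs.le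
  simp only [Pi.mul_apply, Pi.sub_apply, Pi.div_apply, tangentIntercept]
  generalize Real.cos (Real.arctan (κ * (u s / s))) ^ 3 = q
  generalize pull κ (u s / s) = F
  generalize √s = x at hsq hsqrt
  subst hsq
  field_simp
  ring

theorem strictMonoOn_tangentIntercept (h : IsVariation κ u v w o) (hα : 0 ≤ α)
    (hu : ∀ s ∈ Ioo α β, 0 < u s) : StrictMonoOn (tangentIntercept u v) (Icc α β) := by
  refine strictMonoOn_of_hasDerivWithinAt_pos (convex_Icc α β)
    h.continuous_tangentIntercept.continuousOn (f' := fun s => s * pull κ (u s / s))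
    (fun s hs => ?_) fun s hs => ?_ <;> rw [interior_Icc] at hs
  · exact (h.hasDerivAt_tangentIntercept (hα.trans_lt hs.1)).hasDerivWithinAt
  · have hs0 : 0 < s := hα.trans_lt hs.1
    exact mul_pos hs0 (pull_pos (div_pos (hu s hs) hs0))

theorem strictMonoOn_radialWronskian (h : IsVariation κ u v w o) {I : Set ℝ} (hI : Convex ℝ I)
    (hI0 : I ⊆ Ioi 0) (hpos : ∀ s ∈ interior I, 0 < w s * tangentIntercept u v s) :
    StrictMonoOn (radialWronskian κ u v w o) I :=
  strictMonoOn_of_hasDerivWithinAt_pos hI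
    (f' := fun s => 3 / 4 * (w s * tangentIntercept u v s) / (s ^ 2 * √s))
    (fun _ hs => (h.hasDerivAt_radialWronskian (hI0 hs)).continuousAt.continuousWithinAt)
    (fun _ hs => (h.hasDerivAt_radialWronskian (hI0 (interior_subset hs))).hasDerivWithinAt)
    fun s hs => by have := hpos s hs; have : 0 < s := hI0 (interior_subset hs); positivity

theorem wronskian_neg (h : IsVariation κ u v w o) (hκ : κ ≠ 0) (hα : 0 ≤ α) (hαβ : α < β)
    (hwα : w α = 0) (hoα : 0 < o α) (hu : ∀ s ∈ Icc α β, 0 ≤ u s) (hu' : ∀ s ∈ Ioo α β, 0 < u s)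
    (hw : ∀ s ∈ Ioo α β, 0 < w s) : wronskian u v w o β < 0 := by
  have hanti : StrictAntiOn (wronskian u v w o) (Icc α β) := by
    refine strictAntiOn_of_hasDerivWithinAt_neg (convex_Icc α β) h.continuous_wronskian.continuousOn
      (f' := fun s => -(w s * (pull κ (u s / s) -
        u s / s * Real.cos (Real.arctan (κ * (u s / s))) ^ 3)))
      (fun s hs => ?_) fun s hs => ?_ <;> rw [interior_Icc] at hs
    · exact (h.hasDerivAt_wronskian (hα.trans_lt hs.1)).hasDerivWithinAt
    · have := mul_cos_arctan_pow_three_lt_pull hκ (div_pos (hu' s hs) (hα.trans_lt hs.1))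
      exact neg_neg_of_pos (mul_pos (hw s hs) (sub_pos.2 this))
  have hlt := hanti (left_mem_Icc.2 hαβ.le) (right_mem_Icc.2 hαβ.le) hαβ
  have hleft : wronskian u v w o α ≤ 0 := by
    rw [wronskian, hwα, zero_mul, zero_sub]
    exact neg_nonpos.2 (mul_nonneg hoα.le (hu α (left_mem_Icc.2 hαβ.le)))
  exact hlt.trans_le hleft

theorem pos_and_wronskian_neg (h : IsVariation κ u v w o) (hκ : κ ≠ 0) (hα : 0 ≤ α)
    (hwα : w α = 0) (hoα : 0 < o α) (hu : ∀ s ∈ Icc α β, 0 ≤ u s)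
    (hu' : ∀ s ∈ Ioo α β, 0 < u s) : ∀ s ∈ Ioc α β, 0 < w s ∧ wronskian u v w o s < 0 := by
  have hwron : ∀ x ∈ Ioc α β, (∀ y ∈ Ioo α x, 0 < w y) → wronskian u v w o x < 0 := fun x hx =>
    h.wronskian_neg hκ hα hx.1 hwα hoα (fun s hs => hu s ⟨hs.1, hs.2.trans hx.2⟩)
      fun s hs => hu' s ⟨hs.1, hs.2.trans_le hx.2⟩
  have hpos := pos_of_forall_ne_zero h.continuous_w.continuousOn hwα (h.deriv_w α) hoα
    fun x hx hy hwx => by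
      have hneg := hwron x hx hy
      rw [wronskian, hwx, zero_mul, zero_sub, neg_lt_zero] at hneg
      have hox := nonpos_of_hasDerivAt_of_pos_left hx.1 (h.deriv_w x) hy hwx
      exact hneg.not_ge (mul_nonpos_of_nonpos_of_nonneg hox (hu x ⟨hx.1.le, hx.2⟩))
  exact fun s hs => ⟨hpos s hs, hwron s hs fun y hy => hpos y ⟨hy.1, hy.2.le.trans hs.2⟩⟩

theorem exists_tangentIntercept_eq_zero (h : IsVariation κ u v w o) (hα : 0 < α) (hαβ : α < β)
    (huα : u α = 0) (huβ : u β = 0) (hu : ∀ s ∈ Ioo α β, 0 < u s) (hvα : 0 < v α) (hvβ : v β < 0) :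
    ∃ ζ ∈ Ioo α β, tangentIntercept u v ζ = 0 ∧ (∀ s ∈ Ico α ζ, tangentIntercept u v s < 0) ∧
      ∀ s ∈ Ioc ζ β, 0 < tangentIntercept u v s := by
  have hmono := h.strictMonoOn_tangentIntercept hα.le hu
  obtain ⟨ζ, hζ, hζ0⟩ := intermediate_value_Ioo hαβ.le h.continuous_tangentIntercept.continuousOn
    (show (0 : ℝ) ∈ Ioo (tangentIntercept u v α) (tangentIntercept u v β) by
      rw [tangentIntercept, tangentIntercept, huα, huβ, zero_sub, zero_sub]
      exact ⟨neg_neg_of_pos (mul_pos hα hvα),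
        neg_pos.2 (mul_neg_of_pos_of_neg (hα.trans hαβ) hvβ)⟩)
  have hζmem := Ioo_subset_Icc_self hζ
  refine ⟨ζ, hζ, hζ0, fun s hs => ?_, fun s hs => ?_⟩
  · exact (hmono ⟨hs.1, hs.2.le.trans hζ.2.le⟩ hζmem hs.2).trans_eq hζ0
  · exact hζ0.symm.trans_lt (hmono hζmem ⟨hζ.1.le.trans hs.1.le, hs.2⟩ hs.1)

theorem radialWronskian_of_tangentIntercept_eq_zero (hz : tangentIntercept u v s = 0) :
    radialWronskian κ u v w o s = w s * (s * pull κ (u s / s) / √s) := by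
  rw [radialWronskian, hz]
  ring

theorem exists_eq_zero_of_radialWronskian_pos {ζ : ℝ} (h : IsVariation κ u v w o) (hα : 0 < α)
    (hαζ : α < ζ) (huζ : 0 < u ζ) (hz : ∀ s ∈ Ico α ζ, tangentIntercept u v s < 0)
    (hζ : tangentIntercept u v ζ = 0) (hw : w α < 0) (hK : 0 < radialWronskian κ u v w o α) :
    ∃ t ∈ Ioo α ζ, w t = 0 ∧ 0 < o t := by
  have hKpos : ∀ t ∈ Ioc α ζ, (∀ s ∈ Ioo α t, w s < 0) → 0 < radialWronskian κ u v w o t :=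
    fun t ht hneg => hK.trans (h.strictMonoOn_radialWronskian (convex_Icc α t)
      (fun s hs => hα.trans_le hs.1)
      (fun s hs => by
        rw [interior_Icc] at hs
        exact mul_pos_of_neg_of_neg (hneg s hs) (hz s ⟨hs.1.le, hs.2.trans_le ht.2⟩))
      (left_mem_Icc.2 ht.1.le) (right_mem_Icc.2 ht.1.le) ht.1)
  have hζpos : 0 < ζ := hα.trans hαζ
  have hwpos : ∃ x ∈ Icc α ζ, 0 ≤ w x := by
    by_contra! hneg
    have hKζ := hKpos ζ ⟨hαζ, le_rfl⟩ fun s hs => hneg s (Ioo_subset_Icc_self hs)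
    rw [radialWronskian_of_tangentIntercept_eq_zero hζ] at hKζ
    have := pull_pos (κ := κ) (div_pos huζ hζpos)
    exact (hneg ζ ⟨hαζ.le, le_rfl⟩).not_gt (pos_of_mul_pos_left hKζ (by positivity))
  obtain ⟨x, hx, hwx⟩ := hwpos
  obtain ⟨t, ht, hwt, hneg⟩ := exists_first_zero hx.1 h.continuous_w.neg.continuousOn
    (neg_pos.2 hw) (neg_nonpos.2 hwx)
  have hwt : w t = 0 := neg_eq_zero.1 hwt
  have htζ : t ≤ ζ := ht.2.trans hx.2
  have hKt := hKpos t ⟨ht.1, htζ⟩ fun s hs => neg_pos.1 (hneg s ⟨hs.1.le, hs.2⟩)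
  have hzt : tangentIntercept u v t ≤ 0 := htζ.eq_or_lt.elim (fun hEq => hEq ▸ hζ.le)
    fun hlt => (hz t ⟨ht.1.le, hlt⟩).le
  rw [radialWronskian, hwt, zero_mul, zero_mul, zero_mul, zero_div, sub_zero, zero_sub,
    div_pos_iff_of_pos_right (Real.sqrt_pos.2 (hα.trans ht.1)), ← mul_neg] at hKt
  refine ⟨t, ⟨ht.1, htζ.lt_of_ne fun hEq => ?_⟩, hwt,
    pos_of_mul_pos_left hKt (neg_nonneg.2 hzt)⟩
  rw [hEq, hζ, neg_zero, mul_zero] at hKt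
  exact hKt.false

theorem deriv_pos_of_wronskian_neg (hwron : wronskian u v w o s < 0) (hv : v s = 0)
    (hu : 0 ≤ u s) : 0 < o s := by
  rw [wronskian, hv, mul_zero, zero_sub, neg_lt_zero] at hwron
  exact pos_of_mul_pos_left hwron hu

theorem pos_and_radialWronskian_pos (h : IsVariation κ u v w o) (hκ : κ ≠ 0) (hα : 0 < α)
    (hαβ : α < β) (huα : u α = 0) (huβ : u β = 0) (hu : ∀ s ∈ Ioo α β, 0 < u s) (hvα : 0 < v α)
    (hvβ : v β < 0) (hw : w α < 0) (hK : 0 < radialWronskian κ u v w o α) :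
    0 < w β ∧ 0 < radialWronskian κ u v w o β ∧ ∀ s ∈ Ioo α β, v s = 0 → 0 < o s := by
  obtain ⟨ζ, hζ, hζ0, hneg, hpos⟩ :=
    h.exists_tangentIntercept_eq_zero hα hαβ huα huβ hu hvα hvβ
  obtain ⟨t, ht, hwt, hot⟩ :=
    h.exists_eq_zero_of_radialWronskian_pos hα hζ.1 (hu ζ hζ) hneg hζ0 hw hK
  have hζ_pos : 0 < ζ := hα.trans hζ.1
  have htβ : t < β := ht.2.trans hζ.2
  have hafter := h.pos_and_wronskian_neg hκ (hα.trans ht.1).le hwt hot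
    (fun s hs => hs.2.eq_or_lt.elim (fun hEq => hEq ▸ huβ.ge)
      fun hlt => (hu s ⟨ht.1.trans_le hs.1, hlt⟩).le)
    (fun s hs => hu s ⟨ht.1.trans hs.1, hs.2⟩)
  refine ⟨(hafter β ⟨htβ, le_rfl⟩).1, ?_, fun s hs hvs => ?_⟩
  · have hKζ : 0 < radialWronskian κ u v w o ζ := by
      have := (hafter ζ ⟨ht.2, hζ.2.le⟩).1
      have := pull_pos (κ := κ) (div_pos (hu ζ hζ) hζ_pos)
      rw [radialWronskian_of_tangentIntercept_eq_zero hζ0]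
      positivity
    refine hKζ.trans (h.strictMonoOn_radialWronskian (convex_Icc ζ β)
      (fun s hs => hζ_pos.trans_le hs.1) (fun s hs => ?_)
      (left_mem_Icc.2 hζ.2.le) (right_mem_Icc.2 hζ.2.le) hζ.2)
    rw [interior_Icc] at hs
    exact mul_pos (hafter s ⟨ht.2.trans hs.1, hs.2.le⟩).1 (hpos s ⟨hs.1, hs.2.le⟩)
  · have hts : t < s := by
      by_contra! hst
      have hzs := hneg s ⟨hs.1.le, hst.trans_lt ht.2⟩
      rw [tangentIntercept, hvs, mul_zero, sub_zero] at hzs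
      exact hzs.not_gt (hu s hs)
    exact deriv_pos_of_wronskian_neg (hafter s ⟨hts, hs.2.le⟩).2 hvs (hu s hs).le

theorem tendsto_radialWronskian_zero (h : IsVariation κ u v w o) (hu : u 0 = 0) (hw : w 0 = 0) :
    Tendsto (radialWronskian κ u v w o) (𝓝[>] 0) (𝓝 0) := by
  have hlim_u := tendsto_div_nhdsGT_zero (h.deriv_u 0) hu
  have hlim_w := tendsto_div_nhdsGT_zero (h.deriv_w 0) hw
  have hlim {f : ℝ → ℝ} (hf : Continuous f) : Tendsto f (𝓝[>] 0) (𝓝 (f 0)) :=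
    (hf.tendsto 0).mono_left nhdsWithin_le_nhds
  have hpull : Tendsto (fun s => pull κ (u s / s)) (𝓝[>] 0) (𝓝 (pull κ (v 0))) :=
    ((hasDerivAt_pull κ (v 0)).continuousAt.tendsto).comp hlim_u
  have hrescaled : Tendsto (fun s => √s * (s * (w s / s) * pull κ (u s / s) -
      w s / s * (u s / s - v s) / 2 - o s * (u s / s - v s))) (𝓝[>] 0)
      (𝓝 (√0 * (0 * o 0 * pull κ (v 0) - o 0 * (v 0 - v 0) / 2 - o 0 * (v 0 - v 0)))) :=
    (hlim Real.continuous_sqrt).mul (((((hlim continuous_id).mul hlim_w).mul hpull).sub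
      ((hlim_w.mul (hlim_u.sub (hlim h.cont_v))).div_const 2)).sub
      ((hlim h.cont_o).mul (hlim_u.sub (hlim h.cont_v))))
  rw [Real.sqrt_zero, zero_mul] at hrescaled
  refine hrescaled.congr' ?_
  filter_upwards [self_mem_nhdsWithin] with s (hs : 0 < s)
  have hsq : √s ^ 2 = s := Real.sq_sqrt hs.le
  have hsqrt : 0 < √s := Real.sqrt_pos.2 hs
  rw [radialWronskian, tangentIntercept]
  generalize pull κ (u s / s) = F
  generalize √s = x at hsq hsqrt
  subst hsq
  field_simp

theorem pos_and_radialWronskian_pos_of_zero (h : IsVariation κ u v w o) (hκ : κ ≠ 0) (hβ : 0 < β)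
    (hu0 : u 0 = 0) (hw0 : w 0 = 0) (ho0 : 0 < o 0) (huβ : u β = 0) (hu : ∀ s ∈ Ioo 0 β, 0 < u s) :
    0 < w β ∧ 0 < radialWronskian κ u v w o β ∧ ∀ s ∈ Ioo 0 β, v s = 0 → 0 < o s := by
  have hu_nonneg : ∀ s ∈ Icc 0 β, 0 ≤ u s := fun s hs => by
    rcases hs.1.eq_or_lt with rfl | hs0
    · exact hu0.ge
    · exact hs.2.eq_or_lt.elim (fun hEq => hEq ▸ huβ.ge) fun hlt => (hu s ⟨hs0, hlt⟩).le
  have hafter := h.pos_and_wronskian_neg hκ le_rfl hw0 ho0 hu_nonneg hu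
  have hz : ∀ s ∈ Ioc 0 β, 0 < tangentIntercept u v s := fun s hs => by
    have := h.strictMonoOn_tangentIntercept le_rfl hu (left_mem_Icc.2 hβ.le) ⟨hs.1.le, hs.2⟩ hs.1
    rwa [tangentIntercept, hu0, zero_mul, sub_zero] at this
  have hmono : StrictMonoOn (radialWronskian κ u v w o) (Ioc 0 β) :=
    h.strictMonoOn_radialWronskian (convex_Ioc 0 β) (fun s hs => hs.1) fun s hs =>
      have hs := interior_subset hs
      mul_pos (hafter s hs).1 (hz s hs)
  refine ⟨(hafter β ⟨hβ, le_rfl⟩).1, ?_, fun s hs hvs =>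
    deriv_pos_of_wronskian_neg (hafter s ⟨hs.1, hs.2.le⟩).2 hvs (hu s hs).le⟩
  have hhalf : β / 2 ∈ Ioo 0 β := ⟨half_pos hβ, half_lt_self hβ⟩
  refine lt_of_le_of_lt (le_of_tendsto (h.tendsto_radialWronskian_zero hu0 hw0) ?_)
    (hmono ⟨hhalf.1, hhalf.2.le⟩ (right_mem_Ioc.2 hβ) hhalf.2)
  filter_upwards [Ioo_mem_nhdsGT hhalf.1] with s hs
  exact (hmono ⟨hs.1, hs.2.le.trans hhalf.2.le⟩ ⟨hhalf.1, hhalf.2.le⟩ hs.2).le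

end IsVariation

end Variation

section ParameterDerivative

theorem IsVolterra.sub {c₁ c₂ : ℝ} {G G₁ G₂ : ℝ → ℝ → ℝ} {y₁ y₂ : ℝ → ℝ}
    (h₁ : IsVolterra c₁ G₁ y₁) (h₂ : IsVolterra c₂ G₂ y₂)
    (hG₁ : Continuous fun p : ℝ × ℝ => G₁ p.1 p.2) (hG₂ : Continuous fun p : ℝ × ℝ => G₂ p.1 p.2)
    (h : ∀ t, G t (mean y₁ t - mean y₂ t) = G₁ t (mean y₁ t) - G₂ t (mean y₂ t)) :
    IsVolterra (c₁ - c₂) G fun s => y₁ s - y₂ s where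
  cont := h₁.cont.sub h₂.cont
  eq_sub_integral s := by
    simp_rw [mean_sub h₁.cont h₂.cont, h]
    rw [intervalIntegral.integral_sub
      ((continuous_comp_mean hG₁ h₁.cont).intervalIntegrable _ _)
      ((continuous_comp_mean hG₂ h₂.cont).intervalIntegrable _ _),
      h₁.eq_sub_integral s, h₂.eq_sub_integral s]
    ring

theorem IsVolterra.const_mul {c : ℝ} {A y : ℝ → ℝ} (h : IsVolterra c (fun t m => A t * m) y)
    (k : ℝ) : IsVolterra (k * c) (fun t m => A t * m) fun s => k * y s where
  cont := h.cont.const_mul k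
  eq_sub_integral s := by
    simp_rw [mean_const_mul, mul_left_comm _ k]
    rw [intervalIntegral.integral_const_mul, h.eq_sub_integral s, mul_sub]

theorem lipschitzWith_const_mul {K : ℝ≥0} {c : ℝ} (hc : |c| ≤ K) :
    LipschitzWith K fun m : ℝ => c * m :=
  (lipschitzWith_smul c).weaken hc

theorem abs_mean_le {y : ℝ → ℝ} {C : ℝ} (hy : ∀ x, |y x| ≤ C) (t : ℝ) : |mean y t| ≤ C := by
  have hbound : ∀ θ ∈ uIoc (0 : ℝ) 1, ‖y (θ * t)‖ ≤ C := fun θ _ => hy (θ * t)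
  simpa [mean] using intervalIntegral.norm_integral_le_of_norm_le_const hbound

variable {f f' : ℝ → ℝ} {K : ℝ≥0}

theorem mean_mul_sub_eq_sub (hf : ∀ x, HasDerivAt f (f' x) x) (hf' : Continuous f') (x x' : ℝ) :
    mean (fun z => f' (x + z)) (x' - x) * (x' - x) = f x' - f x := by
  rw [mul_comm, ← smul_eq_mul, smul_mean, intervalIntegral.integral_comp_add_left,
    intervalIntegral.integral_eq_sub_of_hasDerivAt (fun z _ => hf z)
      (hf'.intervalIntegrable _ _), add_zero, add_sub_cancel]

theorem hasDerivAt_of_isVolterra {y : ℝ → ℝ → ℝ} {q : ℝ → ℝ} {a : ℝ}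
    (hf : ∀ x, HasDerivAt f (f' x) x) (hf' : Continuous f') (hK : ∀ x, |f' x| ≤ K)
    (hy : ∀ b, IsVolterra b (fun _ => f) (y b))
    (hq : IsVolterra 1 (fun t m => f' (mean (y a) t) * m) q) (s : ℝ) :
    HasDerivAt (fun b => y b s) (q s) a := by
  have hfc : Continuous f := continuous_iff_continuousAt.2 fun x => (hf x).continuousAt
  have hyc : Continuous fun p : ℝ × ℝ => y p.1 p.2 :=
    continuous_uncurry_of_isVolterra (c := fun b => b) (G := fun _ _ => f) (K := K) continuous_id
      (by fun_prop) (fun _ _ => lipschitzWith_of_nnnorm_deriv_le (fun x => (hf x).differentiableAt)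
        fun x => by rw [(hf x).deriv]; exact hK x) hy
  -- The difference quotients `r b` of `y` solve linear equations that depend continuously on `b`.
  set A : ℝ → ℝ → ℝ := fun b t =>
    mean (fun z => f' (mean (y a) t + z)) (mean (y b) t - mean (y a) t)
  have hA : Continuous fun p : ℝ × ℝ => A p.1 p.2 := by
    have := (hy a).cont
    have : Continuous fun p : ℝ × ℝ => mean (y p.1) p.2 := continuous_mean
      (hyc.comp (f := fun x : (ℝ × ℝ) × ℝ => (x.1.1, x.2)) (by fun_prop)) continuous_snd
    fun_prop
  have hlip : ∀ b t, LipschitzWith K fun m => A b t * m := fun b t =>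
    lipschitzWith_const_mul (abs_mean_le (fun z => hK _) _)
  have hG : ∀ b, Continuous fun p : ℝ × ℝ => A b p.1 * p.2 := fun b =>
    (hA.comp (f := fun p : ℝ × ℝ => (b, p.1)) (by fun_prop)).mul continuous_snd
  choose r hr using fun b => exists_isVolterra (1 : ℝ) (hG b) (hlip b) fun _ => mul_zero _
  have hra : r a = q := (hr a).unique (by simpa [A, mean] using hq) (hG a) (hlip a)
  have hquot : ∀ b, (fun s => (b - a) * r b s) = fun s => y b s - y a s := fun b =>
    (by simpa only [mul_one] using (hr b).const_mul (b - a) : IsVolterra (b - a) _ _).unique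
      ((hy b).sub (hy a) (by fun_prop) (by fun_prop) fun t => mean_mul_sub_eq_sub hf hf' _ _)
      (hG b) (hlip b)
  have hr_cont : Continuous fun b => r b s :=
    (continuous_uncurry_of_isVolterra (c := fun _ => (1 : ℝ)) (G := fun b t m => A b t * m)
      continuous_const ((hA.comp (f := fun p : ℝ × ℝ × ℝ => (p.1, p.2.1)) (by fun_prop)).mul
        (by fun_prop)) hlip hr).comp (f := fun b => (b, s)) (by fun_prop)
  rw [hasDerivAt_iff_tendsto_slope, ← hra]
  refine (hr_cont.continuousAt.tendsto.mono_left nhdsWithin_le_nhds).congr' ?_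
  filter_upwards [self_mem_nhdsWithin] with b (hb : b ≠ a)
  rw [slope_def_field, ← congrFun (hquot b) s, mul_div_cancel_left₀ _ (sub_ne_zero.2 hb)]

end ParameterDerivative

section ContinuousInduction

variable {f : ℝ → ℝ} {a b : ℝ}

theorem le_of_eventually_nhdsGT_le (hab : a ≤ b) (hf : ContinuousOn f (Icc a b))
    (h : ∀ x ∈ Ioo a b, ∀ᶠ y in 𝓝[>] x, f x ≤ f y) : f a ≤ f b := by
  rcases hab.eq_or_lt with rfl | hab
  · rfl
  have hle : ∀ c ∈ Ioo a b, f c ≤ f b := fun c hc => by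
    have hclosed : IsClosed ({x | f c ≤ f x} ∩ Icc c b) := by
      rw [inter_comm]
      exact (hf.mono (Icc_subset_Icc_left hc.1.le)).preimage_isClosed_of_isClosed isClosed_Icc
        isClosed_Ici
    refine hclosed.Icc_subset_of_forall_mem_nhdsWithin (le_refl (f c)) (fun x hx => ?_)
      (right_mem_Icc.2 hc.2.le)
    filter_upwards [h x ⟨hc.1.trans_le hx.2.1, hx.2.2⟩] with y hy using hx.1.trans hy
  have := left_nhdsWithin_Ioo_neBot hab
  exact le_of_tendsto ((hf a (left_mem_Icc.2 hab.le)).mono_left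
    (nhdsWithin_mono a Ioo_subset_Icc_self)) (eventually_mem_nhdsWithin.mono hle)

theorem strictMonoOn_Ici_of_eventually_nhdsGT_lt (hf : ContinuousOn f (Ici a))
    (h : ∀ x ∈ Ioi a, ∀ᶠ y in 𝓝[>] x, f x < f y) : StrictMonoOn f (Ici a) := by
  have hle : ∀ x ∈ Ici a, ∀ y, x ≤ y → f x ≤ f y := fun x hx y hxy =>
    le_of_eventually_nhdsGT_le hxy (hf.mono fun z hz => le_trans hx hz.1) fun z hz =>
      (h z (lt_of_le_of_lt hx hz.1)).mono fun _ => le_of_lt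
  intro x hx y _ hxy
  obtain ⟨m, hxm, hmy⟩ := exists_between hxy
  have hm : a < m := lt_of_le_of_lt hx hxm
  obtain ⟨m', hlt, hm'⟩ := ((h m hm).and (Ioo_mem_nhdsGT hmy)).exists
  exact (hle x hx m hxm.le).trans_lt (hlt.trans_le (hle m' (hm.trans hm'.1).le y hm'.2.le))

end ContinuousInduction

section ProfileZeroMonotone

theorem exists_isVolterra_variation (a : ℝ) : ∃ y, IsVolterra 1
    (fun t m => Real.cos (Real.arctan (a * mean (profile a) t)) ^ 3 * m) y :=
  exists_isVolterra 1 (by fun_prop) (fun t => lipschitzWith_const_mul (K := 1) (by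
    rw [abs_of_nonneg (pow_nonneg (Real.cos_arctan_pos _).le 3)]
    exact cos_arctan_pow_three_le_one _)) fun _ => mul_zero _

/-- The derivative of the slope `u_a' = a * profile a` with respect to `a`. -/
noncomputable def variation (a : ℝ) : ℝ → ℝ := (exists_isVolterra_variation a).choose

theorem isVolterra_variation (a : ℝ) : IsVolterra 1
    (fun t m => Real.cos (Real.arctan (a * mean (profile a) t)) ^ 3 * m) (variation a) :=
  (exists_isVolterra_variation a).choose_spec

theorem hasDerivAt_mul_profile (a s : ℝ) :
    HasDerivAt (fun b => b * profile b s) (variation a s) a :=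
  hasDerivAt_of_isVolterra (K := 1) (f := pull 1) (f' := fun x => Real.cos (Real.arctan x) ^ 3)
    (fun x => by simpa only [one_mul] using hasDerivAt_pull 1 x) (by fun_prop)
    (fun x => by
      rw [abs_of_nonneg (pow_nonneg (Real.cos_arctan_pos _).le 3)]
      exact cos_arctan_pow_three_le_one x)
    isVolterra_mul_profile (by simpa only [mean_const_mul] using isVolterra_variation a) s

theorem variation_zero (a : ℝ) : variation a 0 = 1 := (isVolterra_variation a).eq_of_nonpos le_rfl

theorem isVariation_profile (a : ℝ) : IsVariation a (primitive a) (profile a)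
    (fun s => s * mean (variation a) s) (variation a) where
  deriv_u := hasDerivAt_primitive a
  cont_v := by fun_prop
  deriv_v _ := hasDerivAt_profile a
  deriv_w := hasDerivAt_smul_mean (isVolterra_variation a).cont
  cont_o := (isVolterra_variation a).cont
  deriv_o s hs := by
    rw [primitive_div a hs.ne', mul_div_cancel_left₀ _ hs.ne']
    exact ((isVolterra_variation a).hasDerivWithinAt (by fun_prop) hs.le).hasDerivAt
      (Ici_mem_nhds hs)

theorem neg_one_pow_mul_primitive_pos (a : ℝ) (n : ℕ) {s : ℝ}
    (hs : s ∈ Ioo (angleInv (n * Real.pi) a) (angleInv ((n + 1 : ℕ) * Real.pi) a)) :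
    0 < (-1) ^ n * primitive a s := by
  have hs0 : 0 ≤ s := (angleInv_nonneg (by positivity) a).trans hs.1.le
  have hlow := (angleInv_lt_iff (by positivity) a hs0).1 hs.1
  have hupp := (lt_angleInv_iff (by positivity) a hs0).1 hs.2
  push_cast at hupp
  obtain ⟨c, hc, -, hprim⟩ := exists_polar a hs0
  rw [hprim, mul_left_comm, ← Real.sin_sub_nat_mul_pi]
  exact mul_pos hc (Real.sin_pos_of_pos_of_lt_pi (by linarith) (by linarith))

theorem primitive_angleInv_nat_mul_pi (a : ℝ) (n : ℕ) :
    primitive a (angleInv (n * Real.pi) a) = 0 := by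
  obtain ⟨c, -, -, hprim⟩ := exists_polar a (angleInv_nonneg (θ := n * Real.pi) (by positivity) a)
  rw [hprim, angle_angleInv (by positivity), Real.sin_nat_mul_pi, mul_zero]

theorem neg_one_pow_mul_profile_angleInv_pos (a : ℝ) (n : ℕ) :
    0 < (-1) ^ n * profile a (angleInv (n * Real.pi) a) := by
  obtain ⟨c, hc, hprof, -⟩ := exists_polar a (angleInv_nonneg (θ := n * Real.pi) (by positivity) a)
  rwa [hprof, angle_angleInv (by positivity), Real.cos_nat_mul_pi, mul_left_comm, ← mul_pow,
    neg_one_mul, neg_neg, one_pow, mul_one]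

theorem angleInv_nat_mul_pi_lt (a : ℝ) (n : ℕ) :
    angleInv (n * Real.pi) a < angleInv ((n + 1 : ℕ) * Real.pi) a :=
  strictMonoOn_angleInv a (mem_Ici.2 (by positivity)) (mem_Ici.2 (by positivity))
    (mul_lt_mul_of_pos_right (by simp) Real.pi_pos)

/-- Over the `n`-th half-swing the variation lags behind the profile by less than a half-turn. -/
theorem pos_and_radialWronskian_variation_pos {a : ℝ} (ha : a ≠ 0) (n : ℕ) :
    0 < (-1) ^ n * (angleInv ((n + 1 : ℕ) * Real.pi) a *
        mean (variation a) (angleInv ((n + 1 : ℕ) * Real.pi) a)) ∧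
      0 < radialWronskian a (primitive a) (profile a) (fun s => s * mean (variation a) s)
        (variation a) (angleInv ((n + 1 : ℕ) * Real.pi) a) ∧
      ∀ s ∈ Ioo (angleInv (n * Real.pi) a) (angleInv ((n + 1 : ℕ) * Real.pi) a),
        profile a s = 0 → 0 < (-1) ^ n * variation a s := by
  have hvar := isVariation_profile a
  have hpos : ∀ n : ℕ, 0 < angleInv ((n + 1 : ℕ) * Real.pi) a := fun n =>
    angleInv_pos (by positivity) a
  induction n with
  | zero =>
    simpa [angleInv_zero] using hvar.pos_and_radialWronskian_pos_of_zero ha (hpos 0)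
      (primitive_zero a) (zero_mul _) (by rw [variation_zero]; exact one_pos)
      (primitive_angleInv_nat_mul_pi a 1) fun s hs => by
        simpa using neg_one_pow_mul_primitive_pos a 0 (s := s) (by simpa [angleInv_zero] using hs)
  | succ n ih =>
    have hend := neg_one_pow_mul_profile_angleInv_pos a (n + 1 + 1)
    have hstart := ih.1
    rw [pow_succ, mul_neg_one, neg_mul, neg_pos] at hend
    have key := (hvar.neg_one_pow_smul (n + 1)).pos_and_radialWronskian_pos ha (hpos n)
      (angleInv_nat_mul_pi_lt a (n + 1))
      (by rw [Pi.smul_apply, primitive_angleInv_nat_mul_pi, smul_zero])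
      (by rw [Pi.smul_apply, primitive_angleInv_nat_mul_pi, smul_zero])
      (fun s hs => neg_one_pow_mul_primitive_pos a (n + 1) hs)
      (neg_one_pow_mul_profile_angleInv_pos a (n + 1)) hend
      (by simpa [pow_succ] using hstart)
      (by rw [IsVariation.radialWronskian_neg_one_pow_smul]; exact ih.2.1)
    rw [IsVariation.radialWronskian_neg_one_pow_smul] at key
    exact ⟨key.1, key.2.1, fun s hs hzero => key.2.2 s hs (by simp [hzero])⟩

theorem neg_one_pow_mul_variation_profileZero_pos {a : ℝ} (ha : a ≠ 0) (n : ℕ) :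
    0 < (-1) ^ n * variation a (profileZero n a) := by
  have hpi := Real.pi_pos
  refine (pos_and_radialWronskian_variation_pos ha n).2.2 _ ⟨?_, ?_⟩ (profile_profileZero n a) <;>
  · refine strictMonoOn_angleInv a (mem_Ici.2 (by positivity)) (mem_Ici.2 (by positivity)) ?_
    push_cast
    linarith

theorem eventually_profileZero_lt {a : ℝ} (ha : 0 < a) (n : ℕ) :
    ∀ᶠ b in 𝓝[>] a, profileZero n a < profileZero n b := by
  set s := profileZero n a
  have hs : 0 < s := profileZero_pos n a
  have hsign := eventually_sign_eq_of_hasDerivAt_pos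
    ((hasDerivAt_mul_profile a s).const_mul ((-1) ^ n))
    (neg_one_pow_mul_variation_profileZero_pos ha.ne' n)
    (by rw [profile_profileZero, mul_zero, mul_zero])
  have hangle : ∀ᶠ b in 𝓝 a, angle b s < (n + 1 / 2) * Real.pi + Real.pi / 2 := by
    refine (by fun_prop : Continuous fun b => angle b s).continuousAt.eventually_lt_const ?_
    have hs_angle : angle a s = (n + 1 / 2) * Real.pi :=
      angle_angleInv (add_half_mul_pi_pos n).le a
    linarith [Real.pi_pos]
  filter_upwards [nhdsWithin_le_nhds hsign, nhdsWithin_le_nhds hangle, self_mem_nhdsWithin]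
    with b hb hupp (hab : a < b)
  rw [sign_pos (sub_pos.2 hab), sign_eq_one_iff, mul_left_comm] at hb
  obtain ⟨c, hc, hprof, -⟩ := exists_polar b hs.le
  have hcos : 0 < Real.cos (angle b s - n * Real.pi) := by
    rw [Real.cos_sub_nat_mul_pi]
    rw [hprof, mul_left_comm _ c] at hb
    exact pos_of_mul_pos_right (pos_of_mul_pos_right hb (ha.trans hab).le) hc.le
  rw [profileZero, lt_angleInv_iff (add_half_mul_pi_pos n).le b hs.le]
  by_contra! hlow
  exact hcos.not_ge (Real.cos_nonpos_of_pi_div_two_le_of_le (by linarith) (by linarith))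

theorem strictMonoOn_profileZero (n : ℕ) : StrictMonoOn (profileZero n) (Ici 0) :=
  strictMonoOn_Ici_of_eventually_nhdsGT_lt (continuous_profileZero n).continuousOn fun _ ha =>
    eventually_profileZero_lt ha n

theorem le_profileZero (a : ℝ) (n : ℕ) : a ≤ profileZero n a := by
  have hs := profileZero_pos n a
  have heq := (isVolterra_mul_profile a).eq_of_nonneg hs.le
  have hle := intervalIntegral.norm_integral_le_of_norm_le_const (a := (0 : ℝ))
    (b := profileZero n a) (f := fun t => pull 1 (mean (fun s => a * profile a s) t))
    fun t _ => (abs_pull_one_lt _).le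
  rw [sub_zero, one_mul, abs_of_pos hs] at hle
  rw [profile_profileZero, mul_zero, eq_comm, sub_eq_zero] at heq
  exact heq.trans_le ((Real.le_norm_self _).trans hle)

end ProfileZeroMonotone

section PowerSeries

variable {c : ℕ → ℝ}

theorem norm_mul_pow_le (k : ℕ) {t R : ℝ} (ht : |t| ≤ |R|) : ‖c k * t ^ k‖ ≤ ‖c k * R ^ k‖ := by
  rw [norm_mul, norm_mul, norm_pow, norm_pow]
  gcongr
  exact ht

theorem continuous_tsum_mul_pow (hc : ∀ s, Summable fun k => c k * s ^ k) :
    Continuous fun s => ∑' k, c k * s ^ k := by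
  refine continuous_iff_continuousAt.2 fun s => ?_
  have hbound : ∀ k, ∀ t ∈ Ioo (-(|s| + 1)) (|s| + 1), ‖c k * t ^ k‖ ≤ ‖c k * (|s| + 1) ^ k‖ :=
    fun k t ht => norm_mul_pow_le k ((abs_lt.2 ht).le.trans (le_abs_self _))
  exact (continuousOn_tsum (fun k => by fun_prop) (hc _).norm hbound).continuousAt
    (Ioo_mem_nhds (by linarith [neg_abs_le s]) (by linarith [le_abs_self s]))

theorem hasSum_integral_mul_pow {s : ℝ} (hc : Summable fun k => c k * s ^ k) :
    HasSum (fun k => c k / (k + 1) * s ^ (k + 1)) (∫ t in (0 : ℝ)..s, ∑' k, c k * t ^ k) := by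
  have hbound : ∀ k, ∀ t ∈ uIoc 0 s, ‖c k * t ^ k‖ ≤ ‖c k * s ^ k‖ := fun k t ht =>
    norm_mul_pow_le k (by simpa using abs_sub_left_of_mem_uIcc (uIoc_subset_uIcc ht))
  have hsum := intervalIntegral.hasSum_integral_of_dominated_convergence
    (μ := MeasureTheory.volume) (a := 0) (b := s) (F := fun k t => c k * t ^ k)
    (f := fun t => ∑' k, c k * t ^ k) (fun k _ => ‖c k * s ^ k‖)
    (fun k => Continuous.aestronglyMeasurable (by fun_prop))
    (fun k => .of_forall (hbound k)) (.of_forall fun _ _ => hc.norm) (by simp)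
    (.of_forall fun t ht => (hc.norm.of_norm_bounded fun k => hbound k t ht).hasSum)
  refine hsum.congr_fun fun k => ?_
  rw [intervalIntegral.integral_const_mul, integral_pow]
  ring

theorem mean_tsum_mul_pow {t : ℝ} (hc : Summable fun k => c k * t ^ k) :
    mean (fun s => ∑' k, c k * s ^ k) t = ∑' k, c k / (k + 1) * t ^ k := by
  have hsum := hasSum_integral_mul_pow (c := fun k => c k * t ^ k) (s := 1) (by simpa using hc)
  simp only [one_pow, mul_one, mul_div_right_comm _ (t ^ _)] at hsum
  rw [hsum.tsum_eq, mean]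
  simp only [mul_pow, mul_assoc, mul_comm]

end PowerSeries

section Bessel

/-- The entire function `s ↦ J₀ (2 √s)`. -/
noncomputable def besselSeries (s : ℝ) : ℝ := ∑' k : ℕ, (-1) ^ k / (k.factorial : ℝ) ^ 2 * s ^ k

theorem besselSeries_sq_div_four (x : ℝ) : besselSeries (x ^ 2 / 4) = besselJ0 x := by
  rw [besselSeries, besselJ0, show x ^ 2 / 4 = (x / 2) ^ 2 by ring]
  simp only [pow_mul]

theorem summable_besselSeries (s : ℝ) :
    Summable fun k : ℕ => (-1) ^ k / (k.factorial : ℝ) ^ 2 * s ^ k := by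
  refine (Real.summable_pow_div_factorial |s|).of_norm_bounded fun k => ?_
  have hk : (1 : ℝ) ≤ k.factorial := by exact_mod_cast k.factorial_pos
  rw [norm_mul, norm_div, norm_pow, norm_neg, norm_one, one_pow, norm_pow, norm_pow,
    Real.norm_natCast, Real.norm_eq_abs, one_div_mul_eq_div]
  gcongr
  exact le_self_pow₀ hk two_ne_zero

theorem mean_besselSeries (t : ℝ) : mean besselSeries t =
    ∑' k : ℕ, (-1) ^ k / (k.factorial : ℝ) ^ 2 / (k + 1) * t ^ k :=
  mean_tsum_mul_pow (summable_besselSeries t)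

theorem summable_mean_besselSeries (s : ℝ) :
    Summable fun k : ℕ => (-1) ^ k / (k.factorial : ℝ) ^ 2 / (k + 1) * s ^ k := by
  refine (summable_besselSeries s).norm.of_norm_bounded fun k => ?_
  rw [div_mul_eq_mul_div, norm_div]
  exact div_le_self (norm_nonneg _)
    ((le_add_of_nonneg_left k.cast_nonneg).trans (Real.le_norm_self _))

theorem besselSeries_eq_one_sub_integral (s : ℝ) :
    besselSeries s = 1 - ∫ t in (0 : ℝ)..s, mean besselSeries t := by
  have hsum := hasSum_integral_mul_pow (summable_mean_besselSeries s)
  simp_rw [mean_besselSeries]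
  rw [← hsum.tsum_eq, besselSeries, (summable_besselSeries s).tsum_eq_zero_add, sub_eq_add_neg,
    ← tsum_neg]
  congr 1
  · simp
  · refine tsum_congr fun k => ?_
    rw [Nat.factorial_succ, pow_succ (-1 : ℝ)]
    push_cast
    field_simp

theorem isVolterra_besselSeries :
    IsVolterra 1 (fun _ m => pull 0 m) fun s => besselSeries (max s 0) where
  cont := (continuous_tsum_mul_pow summable_besselSeries).comp (by fun_prop)
  eq_sub_integral s := by
    rw [besselSeries_eq_one_sub_integral]
    congr 1
    refine intervalIntegral.integral_congr fun t ht => ?_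
    rw [uIcc_of_le (le_max_right s 0)] at ht
    have hpull : ∀ m, pull 0 m = m := fun m => by simp [pull]
    rw [hpull]
    exact mean_congr ht.1 fun x hx => by rw [max_eq_left hx.1]

theorem profile_zero_eq_besselJ0 (x : ℝ) : profile 0 (x ^ 2 / 4) = besselJ0 x := by
  have h := congrFun ((isVolterra_profile 0).unique isVolterra_besselSeries (by fun_prop)
    fun _ => lipschitzWith_pull 0) (x ^ 2 / 4)
  rwa [max_eq_left (by positivity), besselSeries_sq_div_four] at h

theorem encard_zeros_comp {f φ : ℝ → ℝ} {z : ℝ} (hz : 0 ≤ z) (hφ : StrictMonoOn φ (Icc 0 z))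
    (hcont : ContinuousOn φ (Icc 0 z)) (hzero : φ 0 = 0) :
    {x ∈ Ioo 0 z | f (φ x) = 0}.encard = {y ∈ Ioo 0 (φ z) | f y = 0}.encard := by
  have himage : φ '' Ioo 0 z = Ioo 0 (φ z) := by
    refine Subset.antisymm ?_ (by simpa only [hzero] using intermediate_value_Ioo hz hcont)
    rintro _ ⟨x, hx, rfl⟩
    have hx' := Ioo_subset_Icc_self hx
    exact ⟨hzero ▸ hφ (left_mem_Icc.2 hz) hx' hx.1, hφ hx' (right_mem_Icc.2 hz) hx.2⟩
  have hinj : InjOn φ {x ∈ Ioo 0 z | f (φ x) = 0} :=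
    hφ.injOn.mono fun x hx => Ioo_subset_Icc_self hx.1
  rw [← hinj.encard_image]
  congr 1
  change φ '' (Ioo 0 z ∩ φ ⁻¹' {y | f y = 0}) = _
  rw [image_inter_preimage, himage]
  rfl

theorem isNthZero_besselJ0 (n : ℕ) : IsNthZero besselJ0 (n + 1) (2 * √(profileZero n 0)) := by
  have hτ := profileZero_pos n 0
  have hsq : (2 * √(profileZero n 0)) ^ 2 / 4 = profileZero n 0 := by
    rw [mul_pow, Real.sq_sqrt hτ.le]; ring
  have hpos : 0 < 2 * √(profileZero n 0) := by positivity
  have hmono : StrictMonoOn (fun x : ℝ => x ^ 2 / 4) (Icc 0 (2 * √(profileZero n 0))) :=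
    fun x hx y _ hxy => by
      have := hx.1
      simp only
      gcongr
  refine ⟨hpos, ?_, ?_⟩
  · rw [← profile_zero_eq_besselJ0, hsq, profile_profileZero]
  · simp only [← profile_zero_eq_besselJ0]
    rw [encard_zeros_comp (f := profile 0) (φ := fun x => x ^ 2 / 4) hpos.le hmono (by fun_prop)
      (by norm_num), hsq, encard_profile_zeros_profileZero]
    norm_cast

end Bessel

section Surface

/-- The point of the surface with initial slope `a` and dimensionless length `s`. -/
noncomputable def point (a s : ℝ) : ℝ × ℝ × ℝ := (s, a * primitive a s, a * profile a s)

theorem continuous_point : Continuous fun p : ℝ × ℝ => point p.1 p.2 := by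
  unfold point
  fun_prop

theorem point_injective {a b s : ℝ} (hs : 0 < s) (h : point a s = point b s) : a = b := by
  simp only [point, Prod.mk.injEq, true_and] at h
  have heq : ∀ t ∈ Ioc 0 s, a * profile a t = b * profile b t := fun t ht =>
    (((isShot_profile a).isBranch s).eqOn ((isShot_profile b).isBranch s) h.1 h.2 ht).2
  have hlim : ∀ c, Tendsto (fun t => c * profile c t) (𝓝[>] 0) (𝓝 c) := fun c => by
    have hcont : Continuous fun t => c * profile c t := by fun_prop
    simpa only [profile_zero, mul_one] using (hcont.tendsto 0).mono_left nhdsWithin_le_nhds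
  refine tendsto_nhds_unique (hlim a) ((hlim b).congr' ?_)
  filter_upwards [Ioc_mem_nhdsGT hs] with t ht using (heq t ht).symm

theorem mem_surface_iff {aMax LMax : EReal} {p : ℝ × ℝ × ℝ} :
    p ∈ surface aMax LMax ↔ ∃ a s : ℝ, 0 < a ∧ (a : EReal) < aMax ∧ 0 < s ∧ (s : EReal) < LMax ∧
      p = point a s := by
  constructor
  · rintro ⟨a, s, u, v, ha, haMax, hs, hsMax, hshot, rfl⟩
    obtain ⟨hu, hv⟩ := hshot.eq_profile hs.le
    exact ⟨a, s, ha, haMax, hs, hsMax, by rw [point, hu, hv]⟩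
  · rintro ⟨a, s, ha, haMax, hs, hsMax, rfl⟩
    exact ⟨a, s, _, _, ha, haMax, hs, hsMax, isShot_profile a, rfl⟩

end Surface

section Configuration

variable {μ g L ω : ℝ} {ρ : ℝ → ℝ}

theorem dimlessLength_discreteSpeed (hg : 0 < g) (hL : 0 < L) {t : ℝ} (ht : 0 ≤ t) :
    dimlessLength g L (discreteSpeed g L (2 * √t)) = t := by
  unfold dimlessLength discreteSpeed
  rw [mul_pow, Real.sq_sqrt (by positivity), mul_div_cancel_left₀ _ two_ne_zero, Real.sq_sqrt ht]
  field_simp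

theorem pull_one_div_sqrt_one_sub_sq {x : ℝ} (hx : |x| < 1) : pull 1 (x / √(1 - x ^ 2)) = x := by
  obtain ⟨hlower, hupper⟩ := abs_lt.1 hx
  rw [pull_one, ← Real.arcsin_eq_arctan ⟨hlower, hupper⟩, Real.sin_arcsin hlower.le hupper.le]

theorem pull_one_div_sqrt_one_sub_pull_one_sq (m : ℝ) : pull 1 m / √(1 - pull 1 m ^ 2) = m := by
  rw [pull_one, ← Real.cos_sq', Real.sqrt_sq (Real.cos_arctan_pos m).le, ← Real.tan_eq_sin_div_cos,
    Real.tan_arctan]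

/-- The ratio `ρ' / √(1 - ρ'²)` of the horizontal to the vertical displacement along the chain. -/
noncomputable def steepness (L : ℝ) (ρ : ℝ → ℝ) (s : ℝ) : ℝ :=
  slope L ρ s / √(1 - slope L ρ s ^ 2)

theorem IsConfiguration.hasDerivWithinAt (h : IsConfiguration μ g L ω ρ) {s : ℝ}
    (hs : s ∈ Icc 0 L) : HasDerivWithinAt ρ (pull 1 (steepness L ρ s)) (Icc 0 L) s := by
  rw [steepness, pull_one_div_sqrt_one_sub_sq (h.slope_lt s hs)]
  exact (h.differentiable s hs).hasDerivWithinAt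

theorem IsConfiguration.hasDerivWithinAt_mul_steepness (hμ : 0 < μ) (hg : 0 < g)
    (h : IsConfiguration μ g L ω ρ) {s : ℝ} (hs : s ∈ Icc 0 L) :
    HasDerivWithinAt (fun t => t * steepness L ρ t) (-(ω ^ 2 / g * ρ s)) (Icc 0 L) s := by
  refine (((h.equation s hs).const_mul (μ * g)⁻¹).congr_deriv (by field_simp)).congr_of_mem
    (fun t _ => ?_) hs
  rw [steepness]
  field_simp

theorem isConfiguration_of_hasDerivWithinAt (hg : g ≠ 0) (hL : 0 < L) (hω : 0 < ω) (hρ : 0 < ρ 0)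
    {m : ℝ → ℝ} (hslope : ∀ s ∈ Icc 0 L, HasDerivWithinAt ρ (pull 1 (m s)) (Icc 0 L) s)
    (hm : ∀ s ∈ Icc 0 L,
      HasDerivWithinAt (fun t => t * m t) (-(ω ^ 2 / g * ρ s)) (Icc 0 L) s) :
    IsConfiguration μ g L ω ρ ∧ ∀ s ∈ Icc 0 L, steepness L ρ s = m s := by
  have hslope_eq : ∀ s ∈ Icc 0 L, slope L ρ s = pull 1 (m s) := fun s hs =>
    (hslope s hs).derivWithin (uniqueDiffOn_Icc hL s hs)
  have hsteep : ∀ s ∈ Icc 0 L, steepness L ρ s = m s := fun s hs => by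
    rw [steepness, hslope_eq s hs, pull_one_div_sqrt_one_sub_pull_one_sq]
  refine ⟨⟨hω, hρ, fun s hs => (hslope s hs).differentiableWithinAt, fun s hs => ?_,
    fun s hs => ?_⟩, hsteep⟩
  · rw [hslope_eq s hs]
    exact abs_pull_one_lt _
  · refine (((hm s hs).const_mul (μ * g)).congr_deriv (by field_simp)).congr_of_mem
      (fun t ht => ?_) hs
    rw [← hsteep t ht, steepness]
    ring

theorem IsConfiguration.isBranch (hμ : 0 < μ) (hg : 0 < g) (h : IsConfiguration μ g L ω ρ) {k : ℝ}
    (hk : ω ^ 2 / g = k) :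
    IsBranch 1 (k * L) (fun x => -(x * steepness L ρ (x / k))) (fun x => k * ρ (x / k)) := by
  have hω := h.speed_pos
  have hk₀ : 0 < k := hk ▸ by positivity
  have hmaps : MapsTo (fun x => x / k) (Ioc 0 (k * L)) (Icc 0 L) := fun x hx =>
    ⟨div_nonneg hx.1.le hk₀.le, (div_le_iff₀' hk₀).2 hx.2⟩
  have hdiv : ∀ x, HasDerivWithinAt (fun x => x / k) k⁻¹ (Ioc 0 (k * L)) x := fun x =>
    ((hasDerivAt_id' x).div_const k).hasDerivWithinAt.congr_deriv (one_div k)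
  constructor <;> intro x hx
  · have hu := ((h.hasDerivWithinAt_mul_steepness hμ hg (hmaps hx)).comp x (hdiv x)
      hmaps).const_mul (-k)
    refine (hu.congr_deriv ?_).congr_of_mem (fun t _ => ?_) hx
    · rw [hk]
      field_simp
    · simp only [Function.comp_apply]
      field_simp
  · have hv := ((h.hasDerivWithinAt (hmaps hx)).comp x (hdiv x) hmaps).const_mul k
    refine hv.congr_deriv ?_
    have hx₀ := hx.1.ne'
    rw [neg_div, mul_div_cancel_left₀ _ hx₀, pull_neg]
    field_simp

theorem IsConfiguration.eq_profile (hμ : 0 < μ) (hg : 0 < g)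
    (h : IsConfiguration μ g L ω ρ) {a s : ℝ} (hend : endpoint g L ω ρ = point a s) :
    s = ω ^ 2 / g * L ∧ ∀ t ∈ Ioc 0 L, ω ^ 2 / g * ρ t = a * profile a (ω ^ 2 / g * t) := by
  have hω := h.speed_pos
  obtain ⟨k, hk⟩ : ∃ k, ω ^ 2 / g = k := ⟨_, rfl⟩
  have hk₀ : 0 < k := hk ▸ by positivity
  simp only [endpoint, dimlessLength, mul_div_assoc, hk, point, Prod.mk.injEq] at hend
  obtain ⟨rfl, hu, hv⟩ := hend
  rw [hk, mul_comm k L]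
  refine ⟨rfl, fun t ht => ?_⟩
  have hbranch := h.isBranch hμ hg hk
  rw [mul_comm k L] at hbranch
  have hcancel : ∀ t, k * t / k = t := fun t => mul_div_cancel_left₀ t hk₀.ne'
  have heq := (hbranch.eqOn ((isShot_profile a).isBranch (L * k)) ?_ ?_
    (s := k * t) ⟨mul_pos hk₀ ht.1, by rw [mul_comm L]; gcongr; exact ht.2⟩).2
  · simpa only [hcancel] using heq
  · rw [← hu, mul_div_cancel_right₀ _ hk₀.ne', steepness]
    ring
  · rw [← hv, mul_div_cancel_right₀ _ hk₀.ne', mul_comm]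

theorem IsConfiguration.eq_zero_iff (hμ : 0 < μ) (hg : 0 < g)
    (h : IsConfiguration μ g L ω ρ) {a s : ℝ} (ha : a ≠ 0) (hend : endpoint g L ω ρ = point a s)
    {t : ℝ} (ht : t ∈ Ioc 0 L) : ρ t = 0 ↔ profile a (ω ^ 2 / g * t) = 0 := by
  have hω := h.speed_pos
  have hk : ω ^ 2 / g ≠ 0 := by positivity
  rw [← mul_eq_zero_iff_left hk, (h.eq_profile hμ hg hend).2 t ht, mul_eq_zero_iff_left ha]

theorem IsConfiguration.encard_zeros (hμ : 0 < μ) (hg : 0 < g) (hL : 0 < L)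
    (h : IsConfiguration μ g L ω ρ) {a s : ℝ} (ha : a ≠ 0)
    (hend : endpoint g L ω ρ = point a s) :
    {t ∈ Ioo 0 L | ρ t = 0}.encard = {x ∈ Ioo 0 s | profile a x = 0}.encard := by
  have hω := h.speed_pos
  have hmono : StrictMono fun t => ω ^ 2 / g * t := fun x y hxy => by
    simp only
    gcongr
  rw [(h.eq_profile hμ hg hend).1, ← encard_zeros_comp (f := profile a)
    (φ := fun t => ω ^ 2 / g * t) hL.le (hmono.strictMonoOn _) (by fun_prop) (mul_zero _)]
  congr 1
  ext t
  exact and_congr_right fun ht => h.eq_zero_iff hμ hg ha hend ⟨ht.1, ht.2.le⟩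

theorem IsConfiguration.isNthZero_iff (hμ : 0 < μ) (hg : 0 < g) (hL : 0 < L)
    (h : IsConfiguration μ g L ω ρ) {a s : ℝ} (ha : a ≠ 0)
    (hend : endpoint g L ω ρ = point a s) (n : ℕ) :
    IsNthZero ρ (n + 1) L ↔ s = profileZero n a := by
  have hω := h.speed_pos
  have hs := (h.eq_profile hμ hg hend).1
  have hs₀ : 0 < s := hs ▸ by positivity
  rw [← isNthZero_profile_iff, IsNthZero, IsNthZero, h.encard_zeros hμ hg hL ha hend,
    h.eq_zero_iff hμ hg ha hend ⟨hL, le_rfl⟩, ← hs]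
  simp only [hL, hs₀]

theorem exists_isConfiguration (μ : ℝ) (hg : 0 < g) (hL : 0 < L) {a s : ℝ} (ha : 0 < a)
    (hs : 0 < s) : ∃ ω ρ, IsConfiguration μ g L ω ρ ∧ endpoint g L ω ρ = point a s := by
  obtain ⟨k, hk, rfl⟩ : ∃ k > 0, s = L * k := ⟨s / L, by positivity, by field_simp⟩
  have hω : √(k * g) ^ 2 / g = k := by rw [Real.sq_sqrt (by positivity)]; field_simp
  have hscale : ∀ t, HasDerivWithinAt (fun t => k * t) k (Icc 0 L) t := fun t => by
    simpa using ((hasDerivAt_id' t).const_mul k).hasDerivWithinAt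
  have hslope : ∀ t ∈ Icc 0 L, HasDerivWithinAt (fun t => a / k * profile a (k * t))
      (pull 1 (-(a * mean (profile a) (k * t)))) (Icc 0 L) t := fun t ht => by
    refine (((hasDerivWithinAt_profile a (mul_nonneg hk.le ht.1)).comp t (hscale t)
      fun x hx => mul_nonneg hk.le hx.1).const_mul (a / k)).congr_deriv ?_
    rw [pull_neg, pull_one_mul]
    field_simp
  have hm : ∀ t ∈ Icc 0 L, HasDerivWithinAt (fun t => t * -(a * mean (profile a) (k * t)))
      (-(√(k * g) ^ 2 / g * (a / k * profile a (k * t)))) (Icc 0 L) t := fun t ht => by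
    refine ((((hasDerivAt_primitive a (k * t)).comp_hasDerivWithinAt t (hscale t)).const_mul
      (-(a / k))).congr_deriv ?_).congr_of_mem (fun x _ => ?_) ht
    · rw [hω]
      field_simp
    · simp only [Function.comp_apply, primitive]
      field_simp
  obtain ⟨hconf, hsteep⟩ := isConfiguration_of_hasDerivWithinAt (μ := μ) hg.ne' hL
    (by positivity) (by simp only [mul_zero, profile_zero]; positivity) hslope hm
  refine ⟨_, _, hconf, ?_⟩
  simp only [endpoint, dimlessLength, point, mul_div_assoc, hω, Prod.mk.injEq, true_and]
  constructor
  · rw [← steepness, hsteep L ⟨hL.le, le_rfl⟩, primitive, mul_comm k L]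
    ring
  · rw [mul_comm k L]
    field_simp

end Configuration

section ZeroRadiusLocus

variable {μ g L : ℝ} {aMax LMax : EReal} {n : ℕ}

/-- The curve of the points `(s, u_a s, u_a' s)` for which `s` is the `(n + 1)`-st zero of `u_a'`,
parametrised by the initial slope `a`. -/
noncomputable def zeroCurve (n : ℕ) (a : ℝ) : ℝ × ℝ × ℝ := point a (profileZero n a)

theorem zeroCurve_mem_surface_iff {a : ℝ} : zeroCurve n a ∈ surface aMax LMax ↔
    0 < a ∧ (a : EReal) < aMax ∧ (profileZero n a : EReal) < LMax := by
  rw [mem_surface_iff]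
  constructor
  · rintro ⟨b, s, hb, hbMax, hs, hsMax, heq⟩
    obtain rfl : profileZero n a = s := congrArg Prod.fst heq
    obtain rfl := point_injective hs heq
    exact ⟨hb, hbMax, hsMax⟩
  · rintro ⟨ha, haMax, hsMax⟩
    exact ⟨a, _, ha, haMax, profileZero_pos n a, hsMax, rfl⟩

theorem zeroRadiusLocus_eq (hμ : 0 < μ) (hg : 0 < g) (hL : 0 < L) :
    zeroRadiusLocus μ g L aMax LMax (n + 1) = surface aMax LMax ∩ range (zeroCurve n) := by
  ext p
  refine and_congr_right fun hp => ⟨?_, ?_⟩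
  · rintro ⟨ω, ρ, hconf, hend, hzero⟩
    obtain ⟨a, s, ha, -, -, -, rfl⟩ := mem_surface_iff.1 hp
    obtain rfl := (hconf.isNthZero_iff hμ hg hL ha.ne' hend n).1 hzero
    exact ⟨a, rfl⟩
  · rintro ⟨a, rfl⟩
    have ha := (zeroCurve_mem_surface_iff.1 hp).1
    obtain ⟨ω, ρ, hconf, hend⟩ := exists_isConfiguration μ hg hL ha (profileZero_pos n a)
    exact ⟨ω, ρ, hconf, hend, (hconf.isNthZero_iff hμ hg hL ha.ne' hend n).2 rfl⟩

end ZeroRadiusLocus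

section Separation

variable {μ g L : ℝ} {aMax LMax : EReal} {n : ℕ}

theorem abs_sub_mul_profile_le (a : ℝ) {s : ℝ} (hs : 0 ≤ s) : |a - a * profile a s| ≤ s := by
  have hbound := intervalIntegral.norm_integral_le_of_norm_le_const (a := (0 : ℝ)) (b := s)
    (C := 1) (f := fun t => pull 1 (mean (fun s => a * profile a s) t))
    (fun t _ => (abs_pull_one_lt _).le)
  rw [sub_zero, one_mul, abs_of_nonneg hs] at hbound
  rw [(isVolterra_mul_profile a).eq_of_nonneg hs, sub_sub_cancel]
  exact hbound

/-- Over a neighbourhood of a point of the surface the initial slopes are bounded, and each of their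
cluster points is determined by the limit point. -/
theorem continuousOn_initialSlope {S : Set (ℝ × ℝ × ℝ)} {A : ℝ × ℝ × ℝ → ℝ}
    (hA : ∀ p ∈ S, 0 < p.1 ∧ point (A p) p.1 = p) : ContinuousOn A S := by
  intro p₀ hp₀
  set M := |p₀.2.2| + p₀.1 + 1
  refine (isCompact_Icc (a := -M) (b := M)).tendsto_nhds_of_unique_mapClusterPt ?_ ?_
  · have hcont : Continuous fun p : ℝ × ℝ × ℝ => |p.2.2| + p.1 := by fun_prop
    filter_upwards [self_mem_nhdsWithin, nhdsWithin_le_nhds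
      ((hcont.tendsto p₀).eventually_lt_const (lt_add_one _))] with p hp hpM
    obtain ⟨hpos, heq⟩ := hA p hp
    have hle := abs_sub_mul_profile_le (A p) hpos.le
    rw [show A p * profile (A p) p.1 = p.2.2 from congrArg (·.2.2) heq] at hle
    rw [mem_Icc, ← abs_le]
    linarith [abs_sub_abs_le_abs_sub (A p) p.2.2]
  · intro b _ hb
    obtain ⟨U, hU, hlim⟩ := mapClusterPt_iff_ultrafilter.1 hb
    have hid : Tendsto id (U : Filter (ℝ × ℝ × ℝ)) (𝓝 p₀) := hU.trans nhdsWithin_le_nhds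
    have hpoint : Tendsto (fun p : ℝ × ℝ × ℝ => point (A p) p.1) U (𝓝 (point b p₀.1)) :=
      (continuous_point.tendsto (b, p₀.1)).comp
        (hlim.prodMk_nhds ((continuous_fst.tendsto p₀).comp hid))
    have hpoint' : Tendsto (fun p : ℝ × ℝ × ℝ => point (A p) p.1) U (𝓝 p₀) := by
      refine hid.congr' ?_
      filter_upwards [hU self_mem_nhdsWithin] with p hp using (hA p hp).2.symm
    obtain ⟨hpos, heq⟩ := hA p₀ hp₀
    exact point_injective hpos ((tendsto_nhds_unique hpoint hpoint').trans heq.symm)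

theorem exists_continuousOn_initialSlope (aMax LMax : EReal) : ∃ A : ℝ × ℝ × ℝ → ℝ,
    ContinuousOn A (surface aMax LMax) ∧
      ∀ p ∈ surface aMax LMax, 0 < A p ∧ point (A p) p.1 = p := by
  have hex : ∀ p ∈ surface aMax LMax, ∃ a : ℝ, 0 < a ∧ 0 < p.1 ∧ point a p.1 = p := by
    intro p hp
    obtain ⟨a, s, ha, -, hs, -, rfl⟩ := mem_surface_iff.1 hp
    exact ⟨a, ha, hs, rfl⟩
  choose! A hA using hex
  exact ⟨A, continuousOn_initialSlope fun p hp => (hA p hp).2,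
    fun p hp => ⟨(hA p hp).1, (hA p hp).2.2⟩⟩

theorem encard_zeros_of_mem_rotationMode (hμ : 0 < μ) (hg : 0 < g) (hL : 0 < L) {m : ℕ} {a s : ℝ}
    (ha : a ≠ 0) (hp : point a s ∈ rotationMode μ g L aMax LMax m) :
    {x ∈ Ioo 0 s | profile a x = 0}.encard = m := by
  obtain ⟨-, ω, ρ, hconf, hend, hcard⟩ := hp
  rw [← hconf.encard_zeros hμ hg hL ha hend, hcard]

theorem zeroRadiusLocus_separates (hμ : 0 < μ) (hg : 0 < g) (hL : 0 < L) {T : Set (ℝ × ℝ × ℝ)}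
    (hT : T ⊆ surface aMax LMax) (hconn : IsPreconnected T)
    (hbefore : (T ∩ rotationMode μ g L aMax LMax n).Nonempty)
    (hafter : (T ∩ rotationMode μ g L aMax LMax (n + 1)).Nonempty) :
    (T ∩ zeroRadiusLocus μ g L aMax LMax (n + 1)).Nonempty := by
  obtain ⟨A, hcont, hA⟩ := exists_continuousOn_initialSlope aMax LMax
  have hle_iff : ∀ m, ∀ p ∈ T ∩ rotationMode μ g L aMax LMax m,
      m ≤ n ↔ p.1 ≤ profileZero n (A p) := by
    rintro m p ⟨hpT, hpm⟩
    obtain ⟨ha, heq⟩ := hA p (hT hpT)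
    rw [← heq] at hpm
    rw [← encard_profile_zeros_le_iff, encard_zeros_of_mem_rotationMode hμ hg hL ha.ne' hpm,
      Nat.cast_le]
  obtain ⟨p, hp⟩ := hbefore
  obtain ⟨q, hq⟩ := hafter
  have hp_le : p.1 ≤ profileZero n (A p) := (hle_iff n p hp).1 le_rfl
  have hq_le : profileZero n (A q) ≤ q.1 :=
    le_of_not_ge fun h => Nat.not_succ_le_self n ((hle_iff (n + 1) q hq).2 h)
  obtain ⟨r, hr, hr_eq⟩ := hconn.intermediate_value₂ hp.1 hq.1 continuousOn_fst
    ((continuous_profileZero n).comp_continuousOn (hcont.mono hT)) hp_le hq_le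
  rw [zeroRadiusLocus_eq hμ hg hL]
  refine ⟨r, hr, hT hr, A r, ?_⟩
  rw [zeroCurve, ← Function.comp_apply (f := profileZero n), ← hr_eq, (hA r (hT hr)).2]

end Separation

section Parametrization

theorem eq_univ_or_Iio_of_isOpen_of_isLowerSet {J : Set ℝ≥0} (hopen : IsOpen J)
    (hlower : IsLowerSet J) (hne : J.Nonempty) : J = univ ∨ ∃ A, J = Iio A := by
  refine or_iff_not_imp_left.2 fun huniv => ⟨sSup J, ?_⟩
  obtain ⟨b, hb⟩ := (ne_univ_iff_exists_notMem J).1 huniv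
  have hbdd : BddAbove J := ⟨b, fun x hx => le_of_not_ge fun h => hb (hlower h hx)⟩
  ext x
  constructor
  · intro hx
    obtain ⟨y, hxy, hy⟩ := mem_nhdsGE_iff_exists_Ico_subset.1
      (nhdsWithin_le_nhds (s := Ici x) (hopen.mem_nhds hx))
    obtain ⟨z, hxz, hzy⟩ := exists_between (show x < y from hxy)
    exact hxz.trans_le (le_csSup hbdd (hy ⟨hxz.le, hzy⟩))
  · intro hx
    obtain ⟨y, hy, hxy⟩ := exists_lt_of_lt_csSup hne hx
    exact hlower hxy.le hy

theorem strictMono_div_one_add : StrictMono fun t : ℝ≥0 => t / (1 + t) := fun s t hst => by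
  simp only
  rw [div_lt_div_iff₀ (by positivity) (by positivity), mul_add, mul_add, mul_comm t s]
  simpa using hst

theorem continuous_div_one_add : Continuous fun t : ℝ≥0 => t / (1 + t) :=
  continuous_id.div (by fun_prop) fun t => by positivity

theorem range_mul_div_one_add {A : ℝ≥0} (hA : 0 < A) :
    range (fun t : ℝ≥0 => A * (t / (1 + t))) = Iio A := by
  ext x
  constructor
  · rintro ⟨t, rfl⟩
    have hlt : t / (1 + t) < 1 := by
      rw [div_lt_one (by positivity)]
      exact lt_add_of_pos_left t one_pos
    exact mul_lt_of_lt_one_right hA hlt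
  · intro hx
    have hsub : 0 < A - x := tsub_pos_of_lt hx
    have hone : 1 + x / (A - x) = A / (A - x) := by
      rw [eq_div_iff hsub.ne', add_mul, one_mul, div_mul_cancel₀ _ hsub.ne',
        tsub_add_cancel_of_le (le_of_lt hx)]
    refine ⟨x / (A - x), ?_⟩
    simp only [hone]
    field_simp

theorem exists_strictMono_range_eq {J : Set ℝ≥0} (hopen : IsOpen J) (hlower : IsLowerSet J)
    (hne : J.Nonempty) :
    ∃ φ : ℝ≥0 → ℝ≥0, StrictMono φ ∧ Continuous φ ∧ φ 0 = 0 ∧ range φ = J := by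
  obtain rfl | ⟨A, rfl⟩ := eq_univ_or_Iio_of_isOpen_of_isLowerSet hopen hlower hne
  · exact ⟨id, strictMono_id, continuous_id, rfl, range_id⟩
  · obtain ⟨x, hx⟩ := hne
    have hA : 0 < A := zero_le.trans_lt hx
    exact ⟨fun t => A * (t / (1 + t)), strictMono_div_one_add.const_mul hA,
      continuous_const.mul continuous_div_one_add, by simp, range_mul_div_one_add hA⟩

end Parametrization

section ZeroCurve

variable {aMax LMax : EReal} {n : ℕ}

theorem strictMono_profileZero_coe (n : ℕ) : StrictMono fun a : ℝ≥0 => profileZero n a :=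
  fun a b hab => strictMonoOn_profileZero n a.coe_nonneg b.coe_nonneg hab

theorem continuous_zeroCurve (n : ℕ) : Continuous (zeroCurve n) :=
  continuous_point.comp (continuous_id.prodMk (continuous_profileZero n))

theorem isEmbedding_zeroCurve_comp (n : ℕ) {φ : ℝ≥0 → ℝ≥0} (hmono : StrictMono φ)
    (hcont : Continuous φ) : IsEmbedding fun t => zeroCurve n (φ t) := by
  have hfst : Continuous fun t => profileZero n (φ t) :=
    (continuous_profileZero n).comp (NNReal.continuous_coe.comp hcont)
  exact IsEmbedding.of_comp ((continuous_zeroCurve n).comp (NNReal.continuous_coe.comp hcont))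
    continuous_fst (((strictMono_profileZero_coe n).comp hmono).isEmbedding_of_ordConnected
      (isPreconnected_range hfst).ordConnected)

theorem zeroCurve_zero (n : ℕ) : zeroCurve n 0 = (profileZero n 0, 0, 0) := by
  simp only [zeroCurve, point, zero_mul]

theorem zeroCurve_snd_ne_zero (n : ℕ) {a : ℝ} (ha : a ≠ 0) : (zeroCurve n a).2 ≠ (0, 0) := by
  intro h
  have hpos := profile_sq_add_primitive_sq_pos a (profileZero n a)
  simp only [zeroCurve, point, Prod.mk.injEq, mul_eq_zero, ha, false_or] at h
  simp [h.1, h.2] at hpos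

theorem le_norm_zeroCurve (n : ℕ) (a : ℝ) : a ≤ ‖zeroCurve n a‖ :=
  calc a ≤ profileZero n a := le_profileZero a n
    _ ≤ ‖(zeroCurve n a).1‖ := le_abs_self _
    _ ≤ ‖zeroCurve n a‖ := norm_fst_le _

/-- The parameter interval of the `(n + 1)`-st zero-radius locus, with `0` adjoined. -/
def slopeRange (n : ℕ) (aMax LMax : EReal) : Set ℝ≥0 :=
  {a | ((a : ℝ) : EReal) < aMax ∧ (profileZero n a : EReal) < LMax}

theorem isOpen_slopeRange (n : ℕ) (aMax LMax : EReal) : IsOpen (slopeRange n aMax LMax) :=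
  (isOpen_lt (continuous_coe_real_ereal.comp NNReal.continuous_coe) continuous_const).inter
    (isOpen_lt (continuous_coe_real_ereal.comp
      ((continuous_profileZero n).comp NNReal.continuous_coe)) continuous_const)

theorem isLowerSet_slopeRange (n : ℕ) (aMax LMax : EReal) : IsLowerSet (slopeRange n aMax LMax) :=
  fun _ _ hba ha => ⟨(EReal.coe_le_coe_iff.2 hba).trans_lt ha.1,
    (EReal.coe_le_coe_iff.2 ((strictMono_profileZero_coe n).monotone hba)).trans_lt ha.2⟩

theorem image_zeroCurve_comp {φ : ℝ≥0 → ℝ≥0} (hmono : StrictMono φ) (hzero : φ 0 = 0)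
    (hrange : range φ = slopeRange n aMax LMax) :
    (fun t => zeroCurve n (φ t)) '' Ioi 0 = surface aMax LMax ∩ range (zeroCurve n) := by
  ext p
  constructor
  · rintro ⟨t, ht, rfl⟩
    have hpos : 0 < φ t := hzero ▸ hmono ht
    have hmem : φ t ∈ slopeRange n aMax LMax := hrange ▸ mem_range_self t
    exact ⟨zeroCurve_mem_surface_iff.2 ⟨hpos, hmem⟩, _, rfl⟩
  · rintro ⟨hp, a, rfl⟩
    obtain ⟨ha, hmem⟩ := zeroCurve_mem_surface_iff.1 hp
    lift a to ℝ≥0 using ha.le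
    obtain ⟨t, rfl⟩ : a ∈ range φ := hrange ▸ hmem
    refine ⟨t, ?_, rfl⟩
    rw [mem_Ioi, ← hmono.lt_iff_lt, hzero]
    exact_mod_cast ha

theorem exists_mem_slopeRange_zeroCurve_notMem_surface (hne : (slopeRange n aMax LMax).Nonempty)
    {a l : ℝ} (ha : (a : EReal) < aMax) (hl : (l : EReal) < LMax) :
    ∃ c ∈ slopeRange n aMax LMax, ∀ b : ℝ≥0, c ≤ b → zeroCurve n b ∉ surface a l := by
  suffices hc : ∃ c ∈ slopeRange n aMax LMax, ¬(c < a ∧ profileZero n c < l) by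
    obtain ⟨c, hc, hcal⟩ := hc
    refine ⟨c, hc, fun b hcb hmem => hcal ?_⟩
    obtain ⟨-, hba, hbl⟩ := zeroCurve_mem_surface_iff.1 hmem
    exact ⟨(NNReal.coe_le_coe.2 hcb).trans_lt (EReal.coe_lt_coe_iff.1 hba),
      ((strictMono_profileZero_coe n).monotone hcb).trans_lt (EReal.coe_lt_coe_iff.1 hbl)⟩
  -- Otherwise the interval of slopes would be open and closed, hence all of `ℝ≥0`.
  by_contra! hlt
  have hclosed : IsClosed (slopeRange n aMax LMax) := by
    have heq : slopeRange n aMax LMax = {c : ℝ≥0 | (c : ℝ) ≤ a ∧ profileZero n c ≤ l} :=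
      Subset.antisymm (fun c hc => ⟨(hlt c hc).1.le, (hlt c hc).2.le⟩) fun c hc =>
        ⟨(EReal.coe_le_coe_iff.2 hc.1).trans_lt ha, (EReal.coe_le_coe_iff.2 hc.2).trans_lt hl⟩
    rw [heq]
    exact (isClosed_le NNReal.continuous_coe continuous_const).inter
      (isClosed_le ((continuous_profileZero n).comp NNReal.continuous_coe) continuous_const)
  have huniv := IsClopen.eq_univ ⟨hclosed, isOpen_slopeRange n aMax LMax⟩ hne
  exact (hlt a.toNNReal (huniv ▸ mem_univ _)).1.not_ge (Real.le_coe_toNNReal a)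

theorem exists_zeroRadiusLocus_curve {μ g L : ℝ} (hμ : 0 < μ) (hg : 0 < g) (hL : 0 < L)
    (haMax : 0 < aMax) (hlt : (profileZero n 0 : EReal) < LMax) :
    ∃ γ : ℝ≥0 → ℝ × ℝ × ℝ, IsEmbedding γ ∧ γ 0 = (profileZero n 0, 0, 0) ∧
      γ '' Ioi 0 = zeroRadiusLocus μ g L aMax LMax (n + 1) ∧
      (∀ t, 0 < t → (γ t).2 ≠ (0, 0)) ∧
      (∀ a l : ℝ, (a : EReal) < aMax → (l : EReal) < LMax →
        ∀ᶠ t in atTop, γ t ∉ surface a l) ∧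
      (aMax = ⊤ → LMax = ⊤ → Tendsto γ atTop (cocompact (ℝ × ℝ × ℝ))) := by
  have hne : (slopeRange n aMax LMax).Nonempty := ⟨0, by simpa using haMax, by simpa using hlt⟩
  obtain ⟨φ, hmono, hcont, hzero, hrange⟩ := exists_strictMono_range_eq
    (isOpen_slopeRange n aMax LMax) (isLowerSet_slopeRange n aMax LMax) hne
  have heventually : ∀ c ∈ slopeRange n aMax LMax, ∀ᶠ t in atTop, c ≤ φ t := by
    intro c hc
    obtain ⟨t₀, rfl⟩ : c ∈ range φ := hrange ▸ hc
    filter_upwards [eventually_ge_atTop t₀] with t ht using hmono.monotone ht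
  refine ⟨fun t => zeroCurve n (φ t), isEmbedding_zeroCurve_comp n hmono hcont, ?_, ?_,
    fun t ht => ?_, fun a l ha hl => ?_, ?_⟩
  · simp only [hzero, NNReal.coe_zero, zeroCurve_zero]
  · rw [zeroRadiusLocus_eq hμ hg hL, image_zeroCurve_comp hmono hzero hrange]
  · exact zeroCurve_snd_ne_zero n (NNReal.coe_ne_zero.2 (hzero ▸ hmono ht).ne')
  · obtain ⟨c, hc, hescape⟩ := exists_mem_slopeRange_zeroCurve_notMem_surface hne ha hl
    filter_upwards [heventually c hc] with t ht using hescape _ ht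
  · rintro rfl rfl
    have htop : Tendsto φ atTop atTop := tendsto_atTop.2 fun c =>
      heventually c ⟨EReal.coe_lt_top _, EReal.coe_lt_top _⟩
    rw [← Metric.cobounded_eq_cocompact, ← tendsto_norm_atTop_iff_cobounded]
    exact tendsto_atTop_mono (fun t => le_norm_zeroCurve n _) (NNReal.tendsto_coe_atTop.2 htop)

end ZeroCurve

end RotatingChain

open RotatingChain in
theorem mainTheorem4 (μ g L : ℝ) (hμ : 0 < μ) (hg : 0 < g) (hL : 0 < L)
    (aMax LMax : EReal) (haMax : 0 < aMax) (hLMax : 0 < LMax) (i : ℕ) (hi : 1 ≤ i) :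
    ∃ h : ℝ, IsNthZero besselJ0 i h ∧
      -- (i) the locus is a curve branching out from the first axis and, without bounds, infinite
      ((dimlessLength g L (discreteSpeed g L h) : EReal) < LMax →
        ∃ γ : NNReal → ℝ × ℝ × ℝ, Topology.IsEmbedding γ ∧
          γ 0 = (dimlessLength g L (discreteSpeed g L h), 0, 0) ∧
          γ '' Set.Ioi 0 = zeroRadiusLocus μ g L aMax LMax i ∧
          (∀ t, 0 < t → (γ t).2 ≠ (0, 0)) ∧
          (∀ a l : ℝ, (a : EReal) < aMax → (l : EReal) < LMax →
            ∀ᶠ t in Filter.atTop, γ t ∉ surface a l) ∧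
          (aMax = ⊤ → LMax = ⊤ →
            Filter.Tendsto γ Filter.atTop (Filter.cocompact (ℝ × ℝ × ℝ)))) ∧
      -- (ii) the locus separates mode `i - 1` from mode `i`
      (∀ T : Set (ℝ × ℝ × ℝ), T ⊆ surface aMax LMax → IsPreconnected T →
        (T ∩ rotationMode μ g L aMax LMax (i - 1)).Nonempty →
        (T ∩ rotationMode μ g L aMax LMax i).Nonempty →
        (T ∩ zeroRadiusLocus μ g L aMax LMax i).Nonempty) := by
  obtain ⟨n, rfl⟩ : ∃ n, i = n + 1 := ⟨i - 1, by omega⟩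
  refine ⟨2 * √(profileZero n 0), isNthZero_besselJ0 n, ?_, fun T hT hconn hbefore hafter =>
    zeroRadiusLocus_separates hμ hg hL hT hconn hbefore hafter⟩
  rw [dimlessLength_discreteSpeed hg hL (profileZero_pos n 0).le]
  exact exists_zeroRadiusLocus_curve hμ hg hL haMax
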